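/- Consider a closed chain of $N\ge 3$ sites labelled by $\mathbb Z/N$, with state space $(\mathbb C^2)^{\otimes N}$, vacuum $|\bar 0\rangle=|0\rangle^{\otimes N}$, and at each site $i$ the operators $s_i^\dagger$ ($|0\rangle\mapsto|1\rangle$, $|1\rangle\mapsto 0$) and $s_i=(s_i^\dagger)^*$. Let $|i-j|$ be the distance on the closed chain and, for a set $X$ of sites, $\operatorname{diam}X=1+\max_{i,j\in X}|i-j|$ (with $\operatorname{diam}\emptyset=0$). An operator, not necessarily Hermitian, is supported within $X$ (respectively: has range $R$; is $k$-local) if it is a linear combination of strings $\prod_{j\in A}s_j^\dagger\prod_{l\in B}s_l$ with $A\cup B\subseteq X$ (respectively: $\operatorname{diam}(A\cup B)\le R$; $|A\cup B|\le k$). Put $$\hat n=\sum_i s_i^\dagger s_i,\qquad Q^\dagger=S^\dagger_{(2)}=\sum_{i\in\mathbb Z/N}s_i^\dagger s_{i+1}^\dagger,\qquad |Q^p\rangle=(Q^\dagger)^p|\bar 0\rangle,\qquad |Q\rangle=|Q^1\rangle .$$ There are functions $\alpha,\beta,\gamma:\mathbb N\to\mathbb N$, independent of $N$, with $\alpha(R)\le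 2R+408$, $\beta(r)\le 2^{r+2}+1$ and $\gamma(k)\le 2k$, such that for every $N\ge 3$ one has $[\hat n,Q^\dagger]=2Q^\dagger$ and the following. P.1. Let $H$ have range $R$ with $H|Q\rangle=E|Q\rangle$ for some $E\in\mathbb C$, and suppose that $N>2^{4R}+1$ or that $|\bar 0\rangle$ is an eigenvector of $H$. Then there are $\Omega,\omega\in\mathbb C$ and operators $h_X$ supported within $X$, with $h_X|Q\rangle=h_X|\bar 0\rangle=0$, such that $$H=\Omega I+\omega\,\hat n+\sum_{X:\ \operatorname{diam}X\le\alpha(R)}h_X .\qquad(*)$$ P.2. Let $h_X$, for $\operatorname{diam}X\le r$, be operators supported within $X$ with $h_X|Q\rangle=h_X|\bar 0\rangle=0$. If $\bigl(\sum_{X:\ \operatorname{diam}X\le r}h_X\bigr)|Q^p\rangle=E'_p|Q^p\rangle$ and $p\,\beta(r)\le N$, then $E'_p=0$. P.3. If $H$ is $k$-local and $H|Q^q\rangle=0$ for all $q\le\gamma(k)$, then $H|Q^p\rangle=0$ for all $p$. Equal spacing. If $H$ has range $R$ and is $k$-local, $H|Q^p\rangle=E_p|Q^p\rangle$ for all $p\ge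 0$, and $N>\beta(\alpha(R))\,\gamma(k)$, then there are $\Omega,\omega\in\mathbb C$ for which $H$ has a decomposition $(*)$ and $E_p=\Omega+2\omega p$ for every $p$ with $|Q^p\rangle\ne 0$. -/

import Mathlib

namespace PairTower

noncomputable section

/-- Configurations of hard-core bosons on a closed chain with `N` sites (sites are `ZMod N`, and
`i + 1` is the right neighbour of `i`): each site carries `0` (empty) or `1` (occupied). -/
abbrev Config (N : ℕ) : Type := ZMod N → Fin 2

/-- The state space `(ℂ²)^{⊗N}`: amplitudes in the occupation basis. -/
abbrev State (N : ℕ) : Type := Config N → ℂ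

/-- Linear operators on the state space (not assumed Hermitian). -/
abbrev Op (N : ℕ) : Type := Module.End ℂ (State N)

variable {N : ℕ}

open Classical in
/-- The vacuum, all sites empty. -/
def vacuum (N : ℕ) : State N := fun σ => if ∀ i, σ i = 0 then 1 else 0

/-- `s†_i`: sends `0` to `1` at site `i`, and `1` to the zero vector. -/
def raise (i : ZMod N) : Op N where
  toFun ψ := fun σ => if σ i = 1 then ψ (Function.update σ i 0) else 0
  map_add' ψ φ := by
    funext σ
    by_cases h : σ i = 1 <;> simp [h]
  map_smul' c ψ := by
    funext σ
    by_cases h : σ i = 1 <;> simp [h]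

/-- `s_i`: sends `1` to `0` at site `i`, and `0` to the zero vector. -/
def lower (i : ZMod N) : Op N where
  toFun ψ := fun σ => if σ i = 0 then ψ (Function.update σ i 1) else 0
  map_add' ψ φ := by
    funext σ
    by_cases h : σ i = 0 <;> simp [h]
  map_smul' c ψ := by
    funext σ
    by_cases h : σ i = 0 <;> simp [h]

theorem raise_commute {i j : ZMod N} (hij : i ≠ j) :
    Commute (raise i) (raise j) := by
  apply LinearMap.ext
  intro ψ
  funext σ
  simp only [Module.End.mul_apply, raise, LinearMap.coe_mk, AddHom.coe_mk,
    Function.update_of_ne hij, Function.update_of_ne hij.symm]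
  rw [Function.update_comm hij]
  split_ifs <;> rfl

theorem lower_commute {i j : ZMod N} (hij : i ≠ j) :
    Commute (lower i) (lower j) := by
  apply LinearMap.ext
  intro ψ
  funext σ
  simp only [Module.End.mul_apply, lower, LinearMap.coe_mk, AddHom.coe_mk,
    Function.update_of_ne hij, Function.update_of_ne hij.symm]
  rw [Function.update_comm hij]
  split_ifs <;> rfl

/-- The normal-ordered operator string `∏_{j ∈ A} s†_j ∏_{k ∈ B} s_k`. -/
def opString (A B : Finset (ZMod N)) : Op N :=
  A.noncommProd raise (fun _ _ _ _ h => raise_commute h) *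
    B.noncommProd lower (fun _ _ _ _ h => lower_commute h)

/-- Graph distance on the closed chain. -/
def siteDist (i j : ZMod N) : ℕ := min (i - j).val (j - i).val

/-- `diam X = 1 + max_{i, j ∈ X} |i - j|` (and `0` for the empty set): the smallest `R` such that
all distances within `X` are `< R`. -/
def diam (X : Finset (ZMod N)) : ℕ := (X ×ˢ X).sup fun p => siteDist p.1 p.2 + 1

/-- Operators supported within `X`. -/
def supportedOn (X : Finset (ZMod N)) : Submodule ℂ (Op N) :=
  Submodule.span ℂ {O | ∃ A B : Finset (ZMod N), A ∪ B ⊆ X ∧ O = opString A B}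

/-- Operators of range at most `R`: linear combinations of strings of range at most `R`. -/
def hasRange (N R : ℕ) : Submodule ℂ (Op N) :=
  Submodule.span ℂ {O | ∃ A B : Finset (ZMod N), diam (A ∪ B) ≤ R ∧ O = opString A B}

/-- `k`-local operators: linear combinations of strings that involve at most `k` sites. -/
def kLocal (N k : ℕ) : Submodule ℂ (Op N) :=
  Submodule.span ℂ {O | ∃ A B : Finset (ZMod N), (A ∪ B).card ≤ k ∧ O = opString A B}

/-- The particle number operator `∑_i s†_i s_i`. -/
def number (N : ℕ) [NeZero N] : Op N := ∑ i : ZMod N, raise i * lower i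

/-- The pair creation operator `∑_i s†_i s†_{i+1}`. -/
def pairCreation (N : ℕ) [NeZero N] : Op N := ∑ i : ZMod N, raise i * raise (i + 1)

/-- The tower state `|Q^p⟩ = (Q†)^p |0…0⟩` (not normalized). -/
def tower (Qd : Op N) (p : ℕ) : State N := (Qd ^ p) (vacuum N)

/-- `h X` is supported within `X` and annihilates `|Q⟩` and the vacuum, for each `X` of diameter at
most `r`. -/
def IsAnnihilatorFamily (Qd : Op N) (r : ℕ) (h : Finset (ZMod N) → Op N) : Prop :=
  ∀ X : Finset (ZMod N), diam X ≤ r →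
    h X ∈ supportedOn X ∧ h X (tower Qd 1) = 0 ∧ h X (vacuum N) = 0

/-- The sum of `h X` over all sets of sites `X` with `diam X ≤ r`. -/
def localSum [NeZero N] (r : ℕ) (h : Finset (ZMod N) → Op N) : Op N :=
  ∑ X : Finset (ZMod N) with diam X ≤ r, h X

/-- `H = Ω I + ω ∑_i s†_i s_i + ∑_{diam X ≤ r} h_X` with `h_X` supported within `X` and
`h_X |Q⟩ = h_X |0…0⟩ = 0`. -/
def Decomposes [NeZero N] (Qd : Op N) (r : ℕ) (Ω ω : ℂ) (H : Op N) : Prop :=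
  ∃ h : Finset (ZMod N) → Op N, IsAnnihilatorFamily Qd r h ∧
    H = Ω • (1 : Op N) + ω • number N + localSum r h

/-- Decomposition property (P.1). The chain is long compared with `R` (more than `Δ^{4R} + 1` sites, where
`Δ = 2` is the degree), unless the vacuum is already known to be an eigenstate, in which case no
condition on the length is needed. -/
def PropertyP1 [NeZero N] (Qd : Op N) (α : ℕ → ℕ) : Prop :=
  ∀ (R : ℕ) (H : Op N) (E : ℂ), H ∈ hasRange N R →
    H (tower Qd 1) = E • tower Qd 1 →
    (2 ^ (4 * R) + 1 < N ∨ ∃ E₀ : ℂ, H (vacuum N) = E₀ • vacuum N) →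
    ∃ Ω ω : ℂ, Decomposes Qd (α R) Ω ω H

/-- Annihilation of a finite fraction (P.2); `p * β r ≤ N` is `p ≤ N / β r`. -/
def PropertyP2 [NeZero N] (Qd : Op N) (β : ℕ → ℕ) : Prop :=
  ∀ (r : ℕ) (h : Finset (ZMod N) → Op N), IsAnnihilatorFamily Qd r h →
    ∀ (p : ℕ) (E : ℂ), localSum r h (tower Qd p) = E • tower Qd p →
      p * β r ≤ N → E = 0

/-- Induction on annihilation (P.3). -/
def PropertyP3 (Qd : Op N) (γ : ℕ → ℕ) : Prop :=
  ∀ (k : ℕ) (H : Op N), H ∈ kLocal N k →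
    (∀ q ≤ γ k, H (tower Qd q) = 0) → ∀ p, H (tower Qd p) = 0

end

end PairTower

/-!
The number operator counts two per application of `Q†`, so `Ω + ω n̂` has the tower as eigenvectors
with equally spaced eigenvalues. What remains is how an operator of finite range that annihilates
the vacuum and `|Q⟩` acts.

*Decomposition.* Such an operator is a sum of local ones with the same property. Modulo local
annihilators every string of creation and annihilation operators is a combination of creation
strings `s†_C` and of strings `s†_C s_j s_{j+1}`, one for each `C`, where the pair is anchored at a
site of `C` (`hasRange_le_normalForms`). Strings that lower anything but a subset of a neighbouring
pair annihilate both states; a single `s_i` is traded for `s†_j s_j s_i` with `j = i ± 1`; and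
strings that lower different pairs have the same effect on `|Q⟩`, so that a pair can be moved to its
anchor, if `C` is empty by telescoping around the chain. The creation strings produce distinct basis
states from the vacuum, and the anchored strings produce distinct basis states from `|Q⟩`, so none
of them occurs in an operator that annihilates both (`mem_localAnnihilators_of_apply_eq_zero`).
If the vacuum is not assumed to be an eigenvector, a long chain makes it one: the
amplitude of `H|Q⟩` on a cluster together with a far pair is the amplitude of `H|0…0⟩` on the
cluster, plus that on the far pair if the cluster is itself a pair. These sums vanish, and three far
pairs separate the two terms (`vacuum_eigenvector_of_long`).

*A finite fraction.* Evaluate a sum of local annihilators on `|Q^p⟩` at the configuration of `p`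
pairs at distance `β`. Each term meets at most one pair. The others can be peeled off one by one,
at the cost of a combinatorial factor (`apply_tower_pair_union`), which leaves the term acting on
`|Q⟩` or on the vacuum. The amplitude of `|Q^p⟩` at this configuration is `p!`, so the eigenvalue
vanishes.

*Induction.* The commutator with `Q†` is a derivation that annihilates `s†_i`, and its cube
annihilates `s_i`. Hence its power `2k + 1` annihilates every `k`-local operator `H`, so that
`H|Q^p⟩` is determined by the `H|Q^q⟩` with `q ≤ 2k`
(`apply_tower_eq_zero_of_nilpotent`).
-/

namespace PairTower

/-! ### Occupation basis -/

section Basis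

variable {N : ℕ}

/-- The configuration whose set of occupied sites is `C`. -/
def indicator (C : Finset (ZMod N)) : Config N := fun i => if i ∈ C then 1 else 0

open Classical in
/-- The basis state `|C⟩` in which exactly the sites of `C` are occupied. -/
noncomputable def ket (C : Finset (ZMod N)) : State N :=
  fun σ => if σ = indicator C then 1 else 0

theorem indicator_injective : Function.Injective (indicator (N := N)) := by
  intro C D h
  ext i
  have := congrFun h i
  by_cases h1 : i ∈ C <;> by_cases h2 : i ∈ D <;> simp_all [indicator]

theorem exists_eq_indicator [NeZero N] (σ : Config N) : ∃ C, σ = indicator C := by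
  refine ⟨Finset.univ.filter fun i => σ i = 1, ?_⟩
  funext i
  simp only [indicator, Finset.mem_filter, Finset.mem_univ, true_and]
  split_ifs <;> omega

theorem ket_indicator (C D : Finset (ZMod N)) :
    ket C (indicator D) = if C = D then 1 else 0 := by
  simp only [ket, indicator_injective.eq_iff, eq_comm]

theorem vacuum_eq_ket : vacuum N = ket ∅ := by
  funext σ
  have : (∀ i, σ i = 0) ↔ σ = indicator ∅ := by simp [funext_iff, indicator]
  simp only [vacuum, ket]
  split_ifs <;> tauto

theorem raise_ket (i : ZMod N) (C : Finset (ZMod N)) :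
    raise i (ket C) = if i ∈ C then 0 else ket (insert i C) := by
  funext σ
  simp only [raise, LinearMap.coe_mk, AddHom.coe_mk, ket]
  by_cases hC : i ∈ C
  · have : Function.update σ i 0 ≠ indicator C := fun h => by
      simpa [indicator, hC] using congrFun h i
    simp [hC, this]
  · have : (σ i = 1 ∧ Function.update σ i 0 = indicator C) ↔ σ = indicator (insert i C) := by
      constructor
      · rintro ⟨h1, h2⟩
        funext j
        by_cases hj : j = i
        · subst hj; simp [indicator, h1]
        · have := congrFun h2 j
          simpa [indicator, hj] using this
      · rintro rfl
        refine ⟨by simp [indicator], ?_⟩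
        funext j
        by_cases hj : j = i
        · subst hj; simp [indicator, hC]
        · simp [indicator, hj]
    simp only [hC, if_false, ket]
    split_ifs <;> tauto

theorem lower_ket (i : ZMod N) (C : Finset (ZMod N)) :
    lower i (ket C) = if i ∈ C then ket (C.erase i) else 0 := by
  funext σ
  simp only [lower, LinearMap.coe_mk, AddHom.coe_mk, ket]
  by_cases hC : i ∈ C
  · have : (σ i = 0 ∧ Function.update σ i 1 = indicator C) ↔ σ = indicator (C.erase i) := by
      constructor
      · rintro ⟨h1, h2⟩
        funext j
        by_cases hj : j = i
        · subst hj; simp [indicator, h1]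
        · have := congrFun h2 j
          simpa [indicator, hj] using this
      · rintro rfl
        refine ⟨by simp [indicator], ?_⟩
        funext j
        by_cases hj : j = i
        · subst hj; simp [indicator, hC]
        · simp [indicator, hj]
    simp only [hC, if_true, ket]
    split_ifs <;> tauto
  · have : Function.update σ i 1 ≠ indicator C := fun h => by
      simpa [indicator, hC] using congrFun h i
    simp [hC, this]

theorem pairwise_commute_raise (A : Set (ZMod N)) : A.Pairwise (Function.onFun Commute raise) :=
  fun _ _ _ _ h => raise_commute h

theorem pairwise_commute_lower (A : Set (ZMod N)) : A.Pairwise (Function.onFun Commute lower) :=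
  fun _ _ _ _ h => lower_commute h

theorem opString_eq (A B : Finset (ZMod N)) :
    opString A B = A.noncommProd raise (pairwise_commute_raise _)
      * B.noncommProd lower (pairwise_commute_lower _) := rfl

theorem noncommProd_raise_ket (A D : Finset (ZMod N)) :
    A.noncommProd raise (pairwise_commute_raise _) (ket D)
      = if Disjoint A D then ket (A ∪ D) else 0 := by
  induction A using Finset.induction_on with
  | empty => simp
  | insert a A ha ih =>
    rw [Finset.noncommProd_insert_of_notMem _ _ _ _ ha, Module.End.mul_apply, ih]
    by_cases h : Disjoint A D
    · simp [h, raise_ket, ha, Finset.disjoint_insert_left]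
    · simp [h, Finset.disjoint_insert_left]

theorem noncommProd_lower_ket (B D : Finset (ZMod N)) :
    B.noncommProd lower (pairwise_commute_lower _) (ket D)
      = if B ⊆ D then ket (D \ B) else 0 := by
  induction B using Finset.induction_on with
  | empty => simp
  | insert b B hb ih =>
    rw [Finset.noncommProd_insert_of_notMem _ _ _ _ hb, Module.End.mul_apply, ih]
    by_cases h : B ⊆ D
    · simp [h, lower_ket, hb, Finset.insert_subset_iff, ← Finset.sdiff_insert]
    · simp [h, Finset.insert_subset_iff]

theorem opString_ket (A B D : Finset (ZMod N)) :
    opString A B (ket D)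
      = if B ⊆ D ∧ Disjoint A (D \ B) then ket (A ∪ (D \ B)) else 0 := by
  rw [opString_eq, Module.End.mul_apply, noncommProd_lower_ket]
  by_cases h : B ⊆ D
  · simp [h, noncommProd_raise_ket]
  · simp [h]

theorem opString_empty_empty : opString (∅ : Finset (ZMod N)) ∅ = 1 := by
  simp [opString_eq]

theorem opString_singleton_singleton (i : ZMod N) : opString {i} {i} = raise i * lower i := by
  simp [opString_eq]

theorem opString_vacuum (A B : Finset (ZMod N)) :
    opString A B (vacuum N) = if B = ∅ then ket A else 0 := by
  rw [vacuum_eq_ket, opString_ket]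
  by_cases h : B = ∅ <;> simp [h, Finset.subset_empty]

end Basis

/-! ### Distances on the closed chain -/

section Distance

variable {N : ℕ}

theorem siteDist_eq [NeZero N] (i j : ZMod N) :
    siteDist i j = (i - j).valMinAbs.natAbs := by
  rw [ZMod.valMinAbs_natAbs_eq_min, siteDist, ← neg_sub i j, ZMod.neg_val]
  by_cases h : i - j = 0 <;> simp [h]

theorem siteDist_self (i : ZMod N) : siteDist i i = 0 := by
  simp [siteDist]

theorem siteDist_comm (i j : ZMod N) : siteDist i j = siteDist j i := by
  simp [siteDist, min_comm]

theorem siteDist_triangle [NeZero N] (i j k : ZMod N) :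
    siteDist i k ≤ siteDist i j + siteDist j k := by
  simp only [siteDist_eq]
  have := ZMod.natAbs_valMinAbs_add_le (i - j) (j - k)
  simp only [sub_add_sub_cancel] at this
  exact this.trans (Int.natAbs_add_le _ _)

theorem siteDist_add_natCast_le (i : ZMod N) (m : ℕ) : siteDist i (i + m) ≤ m := by
  refine (min_le_right _ _).trans ?_
  simpa [ZMod.val_natCast] using Nat.mod_le m N

theorem siteDist_add_one_le (i : ZMod N) : siteDist i (i + 1) ≤ 1 := by
  simpa using siteDist_add_natCast_le i 1

/-- Two sites that are `m` steps apart along the chain have distance at least `b`, if both arcs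
between them have length at least `b`. -/
theorem le_siteDist_natCast {b m l : ℕ} (hm : m + b ≤ l) (hl : l + b ≤ N + m) (hb : 0 < b) :
    b ≤ siteDist (m : ZMod N) (l : ZMod N) := by
  have : NeZero N := ⟨by omega⟩
  rw [siteDist, le_min_iff]
  have h1 : ((l : ZMod N) - m).val = l - m := by
    rw [← Nat.cast_sub (by omega), ZMod.val_natCast, Nat.mod_eq_of_lt (by omega)]
  have h2 : ((m : ZMod N) - l).val = N - (l - m) := by
    have : (m : ZMod N) - l = ((N - (l - m) : ℕ) : ZMod N) := by
      rw [Nat.cast_sub (by omega), Nat.cast_sub (by omega)]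
      simp
    rw [this, ZMod.val_natCast, Nat.mod_eq_of_lt (by omega)]
  rw [h1, h2]
  omega

theorem diam_le_iff {X : Finset (ZMod N)} {r : ℕ} :
    diam X ≤ r ↔ ∀ x ∈ X, ∀ y ∈ X, siteDist x y < r := by
  simp only [diam, Finset.sup_le_iff, Finset.mem_product, Prod.forall, and_imp,
    Nat.add_one_le_iff]
  exact ⟨fun h x hx y hy => h x y hx hy, fun h x y hx hy => h x hx y hy⟩

theorem diam_empty : diam (∅ : Finset (ZMod N)) = 0 := by
  simp [diam]

theorem diam_mono {X Y : Finset (ZMod N)} (h : X ⊆ Y) : diam X ≤ diam Y :=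
  Finset.sup_mono (Finset.product_subset_product h h)

/-- Adding sites within distance `m` of a nonempty set enlarges the diameter by at most `2 m`. -/
theorem diam_le_add [NeZero N] {X Y : Finset (ZMod N)} {m r : ℕ} (hX : diam X ≤ r)
    (h : ∀ y ∈ Y, ∃ x ∈ X, siteDist y x ≤ m) : diam Y ≤ r + 2 * m := by
  rw [diam_le_iff] at hX ⊢
  intro y hy z hz
  obtain ⟨x, hx, hyx⟩ := h y hy
  obtain ⟨w, hw, hzw⟩ := h z hz
  have h1 := siteDist_triangle y x z
  have h2 := siteDist_triangle x w z
  have h3 := hX x hx w hw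
  rw [siteDist_comm] at hzw
  omega

end Distance

/-! ### Hard-core boson relations -/

section Relations

variable {N : ℕ}

theorem raise_mul_raise_self (i : ZMod N) : raise i * raise i = 0 := by
  apply LinearMap.ext
  intro ψ
  funext σ
  simp [raise]

theorem lower_mul_raise_add (i : ZMod N) : lower i * raise i + raise i * lower i = 1 := by
  apply LinearMap.ext
  intro ψ
  funext σ
  rcases (by omega : σ i = 0 ∨ σ i = 1) with h | h
  · have : Function.update σ i 0 = σ := by rw [← h, Function.update_eq_self]
    simp [raise, lower, h, this]
  · have : Function.update σ i 1 = σ := by rw [← h, Function.update_eq_self]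
    simp [raise, lower, h, this]

theorem lower_raise_commute {i j : ZMod N} (hij : i ≠ j) : Commute (lower i) (raise j) := by
  apply LinearMap.ext
  intro ψ
  funext σ
  simp only [Module.End.mul_apply, raise, lower, LinearMap.coe_mk, AddHom.coe_mk,
    Function.update_of_ne hij, Function.update_of_ne hij.symm]
  rw [Function.update_comm hij]
  split_ifs <;> rfl

theorem raise_commute' (i j : ZMod N) : Commute (raise i) (raise j) := by
  by_cases h : i = j
  · rw [h]
  · exact raise_commute h

theorem raise_mul_lower_mul_raise (i : ZMod N) : raise i * (lower i * raise i) = raise i := by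
  rw [eq_sub_of_add_eq (lower_mul_raise_add i), mul_sub, ← mul_assoc, raise_mul_raise_self]
  simp

theorem raise_mul_commutator (i : ZMod N) :
    raise i * (lower i * raise i - raise i * lower i) = raise i := by
  rw [mul_sub, raise_mul_lower_mul_raise, ← mul_assoc, raise_mul_raise_self]
  simp

theorem number_commutator_raise [NeZero N] (j : ZMod N) :
    number N * raise j - raise j * number N = raise j := by
  rw [number, Finset.sum_mul, Finset.mul_sum, ← Finset.sum_sub_distrib,
    Finset.sum_eq_single j]
  · rw [mul_assoc, raise_mul_lower_mul_raise, ← mul_assoc, raise_mul_raise_self]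
    simp
  · intro i _ hij
    exact sub_eq_zero.2 ((raise_commute hij).mul_left (lower_raise_commute hij)).eq
  · simp

theorem number_commutator_pairCreation [NeZero N] :
    number N * pairCreation N - pairCreation N * number N = (2 : ℂ) • pairCreation N := by
  rw [pairCreation, Finset.sum_mul, Finset.mul_sum, ← Finset.sum_sub_distrib, Finset.smul_sum]
  refine Finset.sum_congr rfl fun i _ => ?_
  have h1 := number_commutator_raise i
  have h2 := number_commutator_raise (i + 1)
  rw [sub_eq_iff_eq_add] at h1 h2
  rw [← mul_assoc, h1, add_mul, mul_assoc, h2, two_smul]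
  noncomm_ring

theorem number_vacuum [NeZero N] : number N (vacuum N) = 0 := by
  rw [number, LinearMap.sum_apply]
  refine Finset.sum_eq_zero fun i _ => ?_
  rw [Module.End.mul_apply, vacuum_eq_ket, lower_ket]
  simp

theorem tower_zero (Q : Op N) : tower Q 0 = vacuum N := by
  simp [tower]

theorem tower_succ (Q : Op N) (p : ℕ) : tower Q (p + 1) = Q (tower Q p) := by
  simp [tower, pow_succ']

theorem number_tower [NeZero N] (p : ℕ) :
    number N (tower (pairCreation N) p) = (2 * p : ℂ) • tower (pairCreation N) p := by
  induction p with
  | zero => simp [tower_zero, number_vacuum]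
  | succ p ih =>
    have h := number_commutator_pairCreation (N := N)
    rw [sub_eq_iff_eq_add] at h
    rw [tower_succ, ← Module.End.mul_apply, h, LinearMap.add_apply, Module.End.mul_apply, ih]
    simp only [LinearMap.smul_apply, map_smul, ← add_smul]
    push_cast
    ring_nf

theorem commute_opString {a : Op N} {A B : Finset (ZMod N)}
    (hA : ∀ i ∈ A, Commute a (raise i)) (hB : ∀ i ∈ B, Commute a (lower i)) :
    Commute a (opString A B) :=
  (Finset.noncommProd_commute _ _ _ _ hA).mul_right (Finset.noncommProd_commute _ _ _ _ hB)

theorem commute_of_mem_supportedOn {a : Op N} {X : Finset (ZMod N)}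
    (hr : ∀ i ∈ X, Commute a (raise i)) (hl : ∀ i ∈ X, Commute a (lower i))
    {O : Op N} (hO : O ∈ supportedOn X) : Commute a O := by
  induction hO using Submodule.span_induction with
  | mem O h =>
    obtain ⟨A, B, h, rfl⟩ := h
    rw [Finset.union_subset_iff] at h
    exact commute_opString (fun i hi => hr i (h.1 hi)) fun i hi => hl i (h.2 hi)
  | zero => exact Commute.zero_right a
  | add x y _ _ hx hy => exact hx.add_right hy
  | smul c x _ hx => exact hx.smul_right c

end Relations

/-! ### Nilpotency of the commutator with the pair creation operator -/

section Nilpotency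

variable {N : ℕ}

/-- The derivation `X ↦ X Q - Q X`. -/
def commutatorWith (Q : Op N) : Op N →ₗ[ℂ] Op N :=
  LinearMap.mulRight ℂ Q - LinearMap.mulLeft ℂ Q

theorem commutatorWith_apply (Q X : Op N) : commutatorWith Q X = X * Q - Q * X := rfl

theorem commutatorWith_mul (Q X Y : Op N) :
    commutatorWith Q (X * Y) = commutatorWith Q X * Y + X * commutatorWith Q Y := by
  simp only [commutatorWith_apply, sub_mul, mul_sub, mul_assoc]
  abel

/-- Nilpotency degrees of a derivation are subadditive under products, with a gain of one. -/
theorem commutatorWith_pow_mul (Q : Op N) {n a b : ℕ} (hab : a + b ≤ n + 1) {X Y : Op N}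
    (hX : (commutatorWith Q ^ a) X = 0) (hY : (commutatorWith Q ^ b) Y = 0) :
    (commutatorWith Q ^ n) (X * Y) = 0 := by
  induction n generalizing a b X Y with
  | zero =>
    rcases (by omega : a = 0 ∨ b = 0) with rfl | rfl
    · simp_all
    · simp_all
  | succ n ih =>
    rcases a with _ | a
    · simp_all
    rcases b with _ | b
    · simp_all
    rw [pow_succ, Module.End.mul_apply, commutatorWith_mul, map_add,
      ih (a := a) (b := b + 1) (by omega) (by rwa [pow_succ] at hX) hY,
      ih (a := a + 1) (b := b) (by omega) hX (by rwa [pow_succ] at hY), add_zero]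

/-- An operator with nilpotent commutator acts on the tower polynomially: if it annihilates as
many states as the nilpotency degree, it annihilates all. -/
theorem apply_tower_eq_zero_of_nilpotent (Q : Op N) (n : ℕ) (H : Op N)
    (hD : (commutatorWith Q ^ (n + 1)) H = 0) (h : ∀ q ≤ n, H (tower Q q) = 0) (p : ℕ) :
    H (tower Q p) = 0 := by
  have key : ∀ q, H (tower Q (q + 1)) = commutatorWith Q H (tower Q q) + Q (H (tower Q q)) := by
    intro q
    simp [commutatorWith_apply, tower_succ]
  have hstep : ∀ q, commutatorWith Q H (tower Q q) = 0 := by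
    induction n generalizing H with
    | zero =>
      intro q
      rw [zero_add, pow_one] at hD
      simp [hD]
    | succ n ih =>
      have h' : ∀ q ≤ n, commutatorWith Q H (tower Q q) = 0 := by
        intro q hq
        have := key q
        rw [h q (by omega), h (q + 1) (by omega)] at this
        simpa using this.symm
      have key' : ∀ q, commutatorWith Q H (tower Q (q + 1))
          = commutatorWith Q (commutatorWith Q H) (tower Q q)
            + Q (commutatorWith Q H (tower Q q)) := by
        intro q
        rw [commutatorWith_apply Q (commutatorWith Q H)]
        simp [tower_succ]
      have h2 := ih (commutatorWith Q H) (by rwa [pow_succ] at hD) h' key'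
      intro q
      induction q with
      | zero => exact h' 0 (by omega)
      | succ q ihq => rw [key', h2, ihq, map_zero, add_zero]
  induction p with
  | zero => exact h 0 (by omega)
  | succ p ih => rw [key, hstep, ih, map_zero, add_zero]

variable [NeZero N]

theorem commutatorWith_raise (i : ZMod N) : commutatorWith (pairCreation N) (raise i) = 0 := by
  refine sub_eq_zero.2 (Commute.eq ?_)
  exact Commute.sum_right _ _ _ fun j _ => (raise_commute' i j).mul_right (raise_commute' i _)

theorem commutatorWith_lower (hN : 3 ≤ N) (i : ZMod N) :
    commutatorWith (pairCreation N) (lower i)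
      = (lower i * raise i - raise i * lower i) * (raise (i + 1) + raise (i - 1)) := by
  have : Fact (1 < N) := ⟨by omega⟩
  have h1 : i - 1 ≠ i := by simp
  have h2 : i + 1 ≠ i := by simp
  rw [commutatorWith_apply, pairCreation, Finset.mul_sum, Finset.sum_mul,
    ← Finset.sum_sub_distrib, Finset.sum_eq_add i (i - 1) h1.symm]
  · rw [sub_add_cancel]
    have e1 := (lower_raise_commute h2.symm).eq
    have e2 := (lower_raise_commute h1.symm).eq
    have e3 := (raise_commute h2).eq
    have e4 := (raise_commute h1).eq
    have e5 : raise i * (raise (i + 1) * lower i) = raise i * lower i * raise (i + 1) := by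
      rw [← e1, mul_assoc]
    have e6 : lower i * (raise (i - 1) * raise i) = lower i * raise i * raise (i - 1) := by
      rw [e4, mul_assoc]
    have e7 : raise (i - 1) * raise i * lower i = raise i * lower i * raise (i - 1) := by
      rw [e4, mul_assoc, ← e2, mul_assoc]
    rw [mul_assoc (raise i) (raise (i + 1)), e5, e6, e7, mul_add, sub_mul, sub_mul, ← mul_assoc]
  · rintro j - ⟨hj1, hj2⟩
    have hj3 : i ≠ j + 1 := fun h => hj2 (by rw [h]; simp)
    exact sub_eq_zero.2
      ((lower_raise_commute hj1.symm).mul_right (lower_raise_commute hj3)).eq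
  · simp
  · simp

/-- One commutator turns `s_i` into `(1 - 2 s†_i s_i)` times raising operators, the second one
removes the last lowering operator. -/
theorem commutatorWith_pow_three_lower (hN : 3 ≤ N) (i : ZMod N) :
    (commutatorWith (pairCreation N) ^ 3) (lower i) = 0 := by
  have hr : ∀ j, (commutatorWith (pairCreation N) ^ 1) (raise j : Op N) = 0 := fun j => by
    rw [pow_one, commutatorWith_raise]
  have hs : (commutatorWith (pairCreation N) ^ 1) (raise (i + 1) + raise (i - 1)) = 0 := by
    rw [map_add, hr, hr, add_zero]
  rw [pow_succ, Module.End.mul_apply, commutatorWith_lower hN]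
  refine commutatorWith_pow_mul _ (a := 2) (b := 1) le_rfl ?_ hs
  have hm : lower i * raise i - raise i * lower i = 1 - (2 : ℂ) • (raise i * lower i) := by
    rw [eq_sub_of_add_eq (lower_mul_raise_add i), two_smul]
    abel
  rw [pow_succ, Module.End.mul_apply, hm, map_sub, map_smul, commutatorWith_mul,
    commutatorWith_raise, zero_mul, zero_add, commutatorWith_lower hN, ← mul_assoc,
    raise_mul_commutator, commutatorWith_apply, one_mul, mul_one, sub_self, zero_sub, map_neg,
    map_smul, commutatorWith_pow_mul _ (a := 1) (b := 1) le_rfl (hr i) hs, smul_zero, neg_zero]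

theorem commutatorWith_pow_opString (hN : 3 ≤ N) (A B : Finset (ZMod N)) :
    (commutatorWith (pairCreation N) ^ (2 * B.card + 1)) (opString A B) = 0 := by
  rw [opString_eq]
  refine commutatorWith_pow_mul _ (a := 1) (b := 2 * B.card + 1) (by omega) ?_ ?_
  · induction A using Finset.induction_on with
    | empty => simp [commutatorWith_apply]
    | insert a A ha ih =>
      rw [Finset.noncommProd_insert_of_notMem _ _ _ _ ha]
      refine commutatorWith_pow_mul _ (a := 1) (b := 1) le_rfl ?_ ih
      rw [pow_one, commutatorWith_raise]
  · induction B using Finset.induction_on with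
    | empty => simp [commutatorWith_apply]
    | insert b B hb ih =>
      rw [Finset.noncommProd_insert_of_notMem _ _ _ _ hb, Finset.card_insert_of_notMem hb]
      exact commutatorWith_pow_mul _ (by omega) (commutatorWith_pow_three_lower hN b) ih

theorem commutatorWith_pow_kLocal (hN : 3 ≤ N) {k : ℕ} {H : Op N} (hH : H ∈ kLocal N k) :
    (commutatorWith (pairCreation N) ^ (2 * k + 1)) H = 0 := by
  suffices h : kLocal N k ≤ LinearMap.ker (commutatorWith (pairCreation N) ^ (2 * k + 1)) from
    h hH
  refine Submodule.span_le.2 ?_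
  rintro _ ⟨A, B, hAB, rfl⟩
  have hB : B.card ≤ k := (Finset.card_le_card Finset.subset_union_right).trans hAB
  obtain ⟨m, hm⟩ := Nat.exists_eq_add_of_le hB
  rw [SetLike.mem_coe, LinearMap.mem_ker, hm,
    show 2 * (B.card + m) + 1 = 2 * m + (2 * B.card + 1) by ring, pow_add, Module.End.mul_apply,
    commutatorWith_pow_opString hN, map_zero]

theorem propertyP3 (hN : 3 ≤ N) : PropertyP3 (pairCreation N) fun k => 2 * k :=
  fun _ H hH h => apply_tower_eq_zero_of_nilpotent _ _ H (commutatorWith_pow_kLocal hN hH) h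

end Nilpotency

/-! ### Peeling off isolated pairs -/

section Peeling

variable {N : ℕ}

theorem raise_apply_indicator (i : ZMod N) (ψ : State N) (C : Finset (ZMod N)) :
    raise i ψ (indicator C) = if i ∈ C then ψ (indicator (C.erase i)) else 0 := by
  by_cases h : i ∈ C
  · have : Function.update (indicator C) i 0 = indicator (C.erase i) := by
      funext j
      by_cases hj : j = i
      · subst hj; simp [indicator]
      · simp [indicator, hj]
    simp only [raise, LinearMap.coe_mk, AddHom.coe_mk, this]
    simp [indicator, h]
  · simp [raise, indicator, h]

theorem lower_apply_indicator (i : ZMod N) (ψ : State N) (C : Finset (ZMod N)) :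
    lower i ψ (indicator C) = if i ∈ C then 0 else ψ (indicator (insert i C)) := by
  by_cases h : i ∈ C
  · simp [lower, indicator, h]
  · have : Function.update (indicator C) i 1 = indicator (insert i C) := by
      funext j
      by_cases hj : j = i
      · subst hj; simp [indicator]
      · simp [indicator, hj]
    simp only [lower, LinearMap.coe_mk, AddHom.coe_mk, this]
    simp [indicator, h]

/-- The pair of neighbouring sites `i, i + 1`. -/
def pair (i : ZMod N) : Finset (ZMod N) := {i, i + 1}

/-- The pair at `i` together with its two outer neighbours. -/
def collar (i : ZMod N) : Finset (ZMod N) := {i - 1, i, i + 1, i + 2}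

theorem pair_subset_collar (i : ZMod N) : pair i ⊆ collar i := by
  intro x
  simp only [pair, collar, Finset.mem_insert, Finset.mem_singleton]
  tauto

theorem siteDist_le_two_of_mem_collar [NeZero N] {i x : ZMod N} (h : x ∈ collar i) :
    siteDist i x ≤ 2 := by
  simp only [collar, Finset.mem_insert, Finset.mem_singleton] at h
  rcases h with rfl | rfl | rfl | rfl
  · have := siteDist_add_one_le (i - 1)
    rw [sub_add_cancel, siteDist_comm] at this
    omega
  · simp [siteDist_self]
  · have := siteDist_add_one_le i
    omega
  · exact_mod_cast siteDist_add_natCast_le i 2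

theorem siteDist_le_one_of_mem_pair {i x : ZMod N} (h : x ∈ pair i) : siteDist i x ≤ 1 := by
  simp only [pair, Finset.mem_insert, Finset.mem_singleton] at h
  rcases h with rfl | rfl
  · simp [siteDist_self]
  · exact siteDist_add_one_le i

/-- The projection onto states in which the outer neighbours of the pair at `i` are empty. -/
def emptyBoundary (i : ZMod N) : Op N :=
  lower (i - 1) * raise (i - 1) * (lower (i + 2) * raise (i + 2))

/-- Removes a pair at `i` that has empty neighbours. -/
def peel (i : ZMod N) : Op N := emptyBoundary i * (lower i * lower (i + 1))

/-- The projection onto states in which all four sites of the collar of the pair at `i` are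
empty. -/
def emptyCollar (i : ZMod N) : Op N :=
  emptyBoundary i * (lower i * raise i * (lower (i + 1) * raise (i + 1)))

theorem commute_peel_raise {i j : ZMod N} (h : j ∉ collar i) : Commute (peel i) (raise j) := by
  simp only [collar, Finset.mem_insert, Finset.mem_singleton, not_or] at h
  obtain ⟨h1, h2, h3, h4⟩ := h
  exact (((lower_raise_commute (Ne.symm h1)).mul_left (raise_commute' _ _)).mul_left
    ((lower_raise_commute (Ne.symm h4)).mul_left (raise_commute' _ _))).mul_left
    ((lower_raise_commute (Ne.symm h2)).mul_left (lower_raise_commute (Ne.symm h3)))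

theorem commute_peel_lower {i j : ZMod N} (h : j ∉ collar i) : Commute (peel i) (lower j) := by
  simp only [collar, Finset.mem_insert, Finset.mem_singleton, not_or] at h
  obtain ⟨h1, h2, h3, h4⟩ := h
  exact (((lower_commute (Ne.symm h1)).mul_left (lower_raise_commute h1).symm).mul_left
    ((lower_commute (Ne.symm h4)).mul_left (lower_raise_commute h4).symm)).mul_left
    ((lower_commute (Ne.symm h2)).mul_left (lower_commute (Ne.symm h3)))

theorem commute_emptyCollar_raise {i j : ZMod N} (h : j ∉ collar i) :
    Commute (emptyCollar i) (raise j) := by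
  simp only [collar, Finset.mem_insert, Finset.mem_singleton, not_or] at h
  obtain ⟨h1, h2, h3, h4⟩ := h
  exact (((lower_raise_commute (Ne.symm h1)).mul_left (raise_commute' _ _)).mul_left
    ((lower_raise_commute (Ne.symm h4)).mul_left (raise_commute' _ _))).mul_left
    (((lower_raise_commute (Ne.symm h2)).mul_left (raise_commute' _ _)).mul_left
      ((lower_raise_commute (Ne.symm h3)).mul_left (raise_commute' _ _)))

theorem commute_emptyCollar_lower {i j : ZMod N} (h : j ∉ collar i) :
    Commute (emptyCollar i) (lower j) := by
  simp only [collar, Finset.mem_insert, Finset.mem_singleton, not_or] at h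
  obtain ⟨h1, h2, h3, h4⟩ := h
  exact (((lower_commute (Ne.symm h1)).mul_left (lower_raise_commute h1).symm).mul_left
    ((lower_commute (Ne.symm h4)).mul_left (lower_raise_commute h4).symm)).mul_left
    (((lower_commute (Ne.symm h2)).mul_left (lower_raise_commute h2).symm).mul_left
      ((lower_commute (Ne.symm h3)).mul_left (lower_raise_commute h3).symm))

theorem natCast_ne_natCast {N m l : ℕ} (hm : m < N) (hl : l < N) (h : m ≠ l) :
    (m : ZMod N) ≠ l := by
  intro h'
  rw [ZMod.natCast_eq_natCast_iff', Nat.mod_eq_of_lt hm, Nat.mod_eq_of_lt hl] at h'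
  exact h h'

theorem collar_distinct (hN : 4 ≤ N) (i : ZMod N) :
    i - 1 ≠ i ∧ i - 1 ≠ i + 1 ∧ i - 1 ≠ i + 2 ∧ i ≠ i + 1 ∧ i ≠ i + 2 ∧ i + 1 ≠ i + 2 := by
  have h (m : ℕ) (hm : m < N) (hm' : m ≠ 0) : (m : ZMod N) ≠ 0 := by
    simpa using natCast_ne_natCast hm (by omega : 0 < N) hm'
  have h1 := h 1 (by omega) (by omega)
  have h2 := h 2 (by omega) (by omega)
  have h3 := h 3 (by omega) (by omega)
  push_cast at h1 h2 h3
  refine ⟨fun e => h1 ?_, fun e => h2 ?_, fun e => h3 ?_, fun e => h1 ?_, fun e => h2 ?_,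
    fun e => h1 ?_⟩ <;> linear_combination (exp := 1) -e

theorem lower_mul_raise_mul_raise (i : ZMod N) : lower i * raise i * raise i = 0 := by
  rw [mul_assoc, raise_mul_raise_self, mul_zero]

/-- The boundary projection annihilates everything that occupies an outer neighbour. -/
theorem peel_mul_raise_boundary (hN : 4 ≤ N) (i x : ZMod N) (hx : x = i - 1 ∨ x = i + 2) :
    peel i * raise x = 0 ∧ emptyCollar i * raise x = 0 := by
  obtain ⟨h1, h2, h3, h4, h5, h6⟩ := collar_distinct hN i
  have hb : emptyBoundary i * raise x = 0 := by
    rcases hx with rfl | rfl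
    · rw [emptyBoundary, mul_assoc,
        ((lower_raise_commute h3.symm).mul_left (raise_commute' _ _)).eq, ← mul_assoc,
        lower_mul_raise_mul_raise, zero_mul]
    · rw [emptyBoundary, mul_assoc, lower_mul_raise_mul_raise, mul_zero]
  have hl : Commute (lower i) (raise x) ∧ Commute (lower (i + 1)) (raise x) := by
    rcases hx with rfl | rfl
    · exact ⟨lower_raise_commute h1.symm, lower_raise_commute h2.symm⟩
    · exact ⟨lower_raise_commute h5, lower_raise_commute h6⟩
  constructor
  · rw [peel, mul_assoc, (hl.1.mul_left hl.2).eq, ← mul_assoc, hb, zero_mul]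
  · rw [emptyCollar, mul_assoc, ((hl.1.mul_left (raise_commute' _ _)).mul_left
      (hl.2.mul_left (raise_commute' _ _))).eq, ← mul_assoc, hb, zero_mul]

theorem peel_emptyCollar_mul_raise_raise (hN : 4 ≤ N) (i j : ZMod N)
    (hj : j ∈ collar i ∨ j + 1 ∈ collar i) (hij : j ≠ i) :
    peel i * (raise j * raise (j + 1)) = 0 ∧ emptyCollar i * (raise j * raise (j + 1)) = 0 := by
  have hx : (j = i - 1 ∨ j = i + 2) ∨ (j + 1 = i - 1 ∨ j + 1 = i + 2) := by
    simp only [collar, Finset.mem_insert, Finset.mem_singleton] at hj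
    rcases hj with (h | h | h | h) | (h | h | h | h)
    · exact Or.inl (Or.inl h)
    · exact absurd h hij
    · exact Or.inr (Or.inr (by rw [h]; ring))
    · exact Or.inl (Or.inr h)
    · exact Or.inr (Or.inl h)
    · exact Or.inl (Or.inl (by rw [← h]; ring))
    · exact absurd (add_right_cancel h) hij
    · exact Or.inr (Or.inr h)
  rcases hx with h | h
  · have := peel_mul_raise_boundary hN i j h
    rw [← mul_assoc, ← mul_assoc, this.1, this.2, zero_mul]
    exact ⟨rfl, rfl⟩
  · have := peel_mul_raise_boundary hN i _ h
    rw [(raise_commute' j (j + 1)).eq, ← mul_assoc, ← mul_assoc, this.1, this.2, zero_mul]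
    exact ⟨rfl, rfl⟩

theorem peel_apply_indicator (hN : 4 ≤ N) {i : ZMod N} {C : Finset (ZMod N)}
    (h : Disjoint (collar i) C) (ψ : State N) :
    peel i ψ (indicator C) = ψ (indicator (pair i ∪ C)) := by
  obtain ⟨h1, h2, h3, h4, h5, h6⟩ := collar_distinct hN i
  simp only [collar, Finset.disjoint_insert_left, Finset.disjoint_singleton_left] at h
  obtain ⟨g1, g2, g3, g4⟩ := h
  simp only [peel, emptyBoundary, Module.End.mul_apply, lower_apply_indicator,
    raise_apply_indicator, g1, g2, g3, g4, if_false, Finset.mem_insert_self, if_true,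
    Finset.erase_insert g1, Finset.erase_insert g4, Finset.mem_insert, h4.symm, or_self]
  congr 2
  ext x
  simp only [pair, Finset.mem_union, Finset.mem_insert, Finset.mem_singleton]
  tauto

theorem emptyCollar_apply_indicator {i : ZMod N} {C : Finset (ZMod N)}
    (h : Disjoint (collar i) C) (ψ : State N) :
    emptyCollar i ψ (indicator C) = ψ (indicator C) := by
  simp only [collar, Finset.disjoint_insert_left, Finset.disjoint_singleton_left] at h
  obtain ⟨g1, g2, g3, g4⟩ := h
  simp only [emptyCollar, emptyBoundary, Module.End.mul_apply, lower_apply_indicator,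
    raise_apply_indicator, g1, g2, g3, g4, if_false, Finset.mem_insert_self, if_true,
    Finset.erase_insert g1, Finset.erase_insert g2, Finset.erase_insert g3,
    Finset.erase_insert g4]

variable [NeZero N]

/-- Pair creation away from the collar of the pair at `i`. -/
def farPairCreation (i : ZMod N) : Op N :=
  ∑ j : ZMod N with j ∉ collar i ∧ j + 1 ∉ collar i, raise j * raise (j + 1)

theorem commute_farPairCreation {a : Op N} {i : ZMod N} (ha : ∀ j ∉ collar i, Commute a (raise j)) :
    Commute a (farPairCreation i) := by
  refine Commute.sum_right _ _ _ fun j hj => ?_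
  rw [Finset.mem_filter] at hj
  exact (ha j hj.2.1).mul_right (ha _ hj.2.2)

theorem peel_mul_pairCreation (hN : 4 ≤ N) (i : ZMod N) :
    peel i * pairCreation N = emptyCollar i + farPairCreation i * peel i := by
  have hi : i ∈ collar i := pair_subset_collar i (by simp [pair])
  rw [← (commute_farPairCreation fun j => commute_peel_raise).eq, pairCreation, farPairCreation,
    Finset.mul_sum, Finset.mul_sum,
    ← Finset.sum_filter_not_add_sum_filter _ (fun j => j ∉ collar i ∧ j + 1 ∉ collar i)]
  congr 1
  rw [Finset.sum_eq_single i]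
  · obtain ⟨-, -, -, h4, -, -⟩ := collar_distinct hN i
    rw [peel, emptyCollar, mul_assoc]
    congr 1
    rw [mul_assoc, ← mul_assoc (lower (i + 1)), (lower_raise_commute h4.symm).eq]
    simp only [mul_assoc]
  · intro j hj hij
    rw [Finset.mem_filter] at hj
    exact (peel_emptyCollar_mul_raise_raise hN i j (by tauto) hij).1
  · intro h
    exact absurd (Finset.mem_filter.2 ⟨Finset.mem_univ _, fun h' => h'.1 hi⟩) h

theorem emptyCollar_mul_pairCreation (hN : 4 ≤ N) (i : ZMod N) :
    emptyCollar i * pairCreation N = farPairCreation i * emptyCollar i := by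
  rw [← (commute_farPairCreation fun j => commute_emptyCollar_raise).eq, pairCreation,
    farPairCreation, Finset.mul_sum, Finset.mul_sum,
    ← Finset.sum_filter_not_add_sum_filter _ (fun j => j ∉ collar i ∧ j + 1 ∉ collar i),
    Finset.sum_eq_zero, zero_add]
  intro j hj
  rw [Finset.mem_filter] at hj
  by_cases hij : j = i
  · subst hij
    obtain ⟨-, -, -, h4, -, -⟩ := collar_distinct hN j
    rw [emptyCollar, mul_assoc, mul_assoc (lower j * raise j), ← mul_assoc (lower (j + 1) * _),
      ((lower_raise_commute h4.symm).mul_left (raise_commute' _ _)).eq, mul_assoc (raise j),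
      lower_mul_raise_mul_raise, mul_zero, mul_zero, mul_zero]
  · exact (peel_emptyCollar_mul_raise_raise hN i j (by tauto) hij).2

/-- Peeling one isolated pair off the tower: `Q†` acts as a derivation across the collar. -/
theorem peel_tower (hN : 4 ≤ N) (i : ZMod N) (p : ℕ) :
    peel i (tower (pairCreation N) (p + 1))
      = (p + 1 : ℂ) • emptyCollar i (tower (pairCreation N) p) := by
  have hp : ∀ ψ, peel i (pairCreation N ψ) = emptyCollar i ψ + farPairCreation i (peel i ψ) :=
    fun ψ => LinearMap.congr_fun (peel_mul_pairCreation hN i) ψ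
  have hc : ∀ ψ, emptyCollar i (pairCreation N ψ) = farPairCreation i (emptyCollar i ψ) :=
    fun ψ => LinearMap.congr_fun (emptyCollar_mul_pairCreation hN i) ψ
  induction p with
  | zero =>
    have : peel i (vacuum N) = 0 := by
      simp [peel, vacuum_eq_ket, lower_ket]
    rw [tower_succ, hp, tower_zero, this]
    simp
  | succ p ih =>
    rw [tower_succ, hp, ih, tower_succ _ p, hc, map_smul]
    push_cast
    module

/-- An operator supported away from an isolated pair does not notice that pair, up to the
combinatorial factor `p + 1`. -/
theorem apply_tower_pair_union (hN : 4 ≤ N) {i : ZMod N} {X C : Finset (ZMod N)}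
    (hC : Disjoint (collar i) C) (hX : Disjoint (collar i) X) {h : Op N}
    (hh : h ∈ supportedOn X) (p : ℕ) :
    h (tower (pairCreation N) (p + 1)) (indicator (pair i ∪ C))
      = (p + 1) * h (tower (pairCreation N) p) (indicator C) := by
  have hX' : ∀ x ∈ X, x ∉ collar i := fun x hx hx' => Finset.disjoint_left.1 hX hx' hx
  have h1 : Commute (peel i) h := commute_of_mem_supportedOn
    (fun x hx => commute_peel_raise (hX' x hx)) (fun x hx => commute_peel_lower (hX' x hx)) hh
  have h2 : Commute (emptyCollar i) h := commute_of_mem_supportedOn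
    (fun x hx => commute_emptyCollar_raise (hX' x hx))
    (fun x hx => commute_emptyCollar_lower (hX' x hx)) hh
  have h1' := LinearMap.congr_fun h1.eq (tower (pairCreation N) (p + 1))
  have h2' := LinearMap.congr_fun h2.eq (tower (pairCreation N) p)
  simp only [Module.End.mul_apply] at h1' h2'
  rw [← peel_apply_indicator hN hC (h _), h1', peel_tower hN, map_smul, ← h2', Pi.smul_apply,
    emptyCollar_apply_indicator hC, smul_eq_mul]

end Peeling

/-! ### Annihilating a finite fraction of the tower -/

section FiniteFraction

variable {N : ℕ}

/-- Pairs placed at the sites `m * b` for `m ∈ S`. -/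
def spacedPairs (N b : ℕ) (S : Finset ℕ) : Finset (ZMod N) :=
  S.biUnion fun m => pair ((m * b : ℕ) : ZMod N)

theorem le_siteDist_mul {b p m l : ℕ} (hb : 0 < b) (hp : p * b ≤ N) (hm : m < p) (hl : l < p)
    (h : m ≠ l) : b ≤ siteDist ((m * b : ℕ) : ZMod N) ((l * b : ℕ) : ZMod N) := by
  wlog hlt : m < l generalizing m l
  · rw [siteDist_comm]
    exact this hl hm h.symm (by omega)
  have h1 : (m + 1) * b ≤ l * b := Nat.mul_le_mul_right _ hlt
  have h2 : (l + 1) * b ≤ p * b := Nat.mul_le_mul_right _ hl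
  rw [add_one_mul] at h1 h2
  exact le_siteDist_natCast h1 (by omega) hb

theorem spacedPairs_insert (b m : ℕ) (S : Finset ℕ) :
    spacedPairs N b (insert m S) = pair ((m * b : ℕ) : ZMod N) ∪ spacedPairs N b S := by
  rw [spacedPairs, Finset.biUnion_insert, spacedPairs]

variable [NeZero N]

theorem disjoint_collar_spacedPairs {b p m : ℕ} {S : Finset ℕ} (hb : 4 ≤ b) (hp : p * b ≤ N)
    (hm : m < p) (hS : ∀ l ∈ S, l < p) (hmS : m ∉ S) :
    Disjoint (collar ((m * b : ℕ) : ZMod N)) (spacedPairs N b S) := by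
  rw [spacedPairs, Finset.disjoint_biUnion_right]
  intro l hl
  rw [Finset.disjoint_left]
  intro x hx hx'
  have h1 := siteDist_le_two_of_mem_collar hx
  have h2 := siteDist_le_one_of_mem_pair hx'
  have h3 := le_siteDist_mul (by omega) hp hm (hS l hl) (fun h => hmS (h ▸ hl))
  have h4 := siteDist_triangle ((m * b : ℕ) : ZMod N) x ((l * b : ℕ) : ZMod N)
  rw [siteDist_comm x] at h4
  omega

theorem tower_spacedPairs {b p : ℕ} (hb : 4 ≤ b) (hp : p * b ≤ N) (S : Finset ℕ)
    (hS : ∀ l ∈ S, l < p) :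
    tower (pairCreation N) S.card (indicator (spacedPairs N b S)) = S.card.factorial := by
  induction S using Finset.induction_on with
  | empty => simp [tower_zero, vacuum_eq_ket, spacedPairs, ket_indicator]
  | insert m S hm ih =>
    have hmp : m < p := hS m (Finset.mem_insert_self _ _)
    have hN : 4 ≤ N := hb.trans ((Nat.le_mul_of_pos_left b (by omega)).trans hp)
    have h := apply_tower_pair_union hN (X := ∅)
      (disjoint_collar_spacedPairs hb hp hmp (fun l hl => hS l (Finset.mem_insert_of_mem hl)) hm)
      (Finset.disjoint_empty_right _) (h := 1)
      (Submodule.subset_span ⟨∅, ∅, by simp, opString_empty_empty.symm⟩) S.card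
    rw [Module.End.one_apply, Module.End.one_apply,
      ih fun l hl => hS l (Finset.mem_insert_of_mem hl)] at h
    rw [spacedPairs_insert, Finset.card_insert_of_notMem hm, h, Nat.factorial_succ]
    push_cast
    rfl

/-- A local annihilator of the vacuum and of `|Q⟩` meets at most one of the spaced pairs; after
the others are peeled off, it acts on the vacuum or on `|Q⟩`. -/
theorem apply_tower_spacedPairs_eq_zero {b p r : ℕ} (hb : 4 ≤ b) (hr : r + 3 < b)
    (hp : p * b ≤ N) {X : Finset (ZMod N)} (hX : diam X ≤ r) {h : Op N}
    (hh : h ∈ supportedOn X) (h1 : h (tower (pairCreation N) 1) = 0) (h0 : h (vacuum N) = 0)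
    (S : Finset ℕ) (hS : ∀ l ∈ S, l < p) :
    h (tower (pairCreation N) S.card) (indicator (spacedPairs N b S)) = 0 := by
  induction hn : S.card generalizing S with
  | zero => rw [tower_zero, h0]; rfl
  | succ n ih =>
    rcases n with _ | n
    · rw [h1]; rfl
    have hex : ∃ m ∈ S, Disjoint (collar ((m * b : ℕ) : ZMod N)) X := by
      obtain ⟨m, hm, l, hl, hml⟩ := Finset.one_lt_card.1 (by omega : 1 < S.card)
      by_contra! hcon
      obtain ⟨x, hx, hxX⟩ := Finset.not_disjoint_iff.1 (hcon m hm)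
      obtain ⟨y, hy, hyX⟩ := Finset.not_disjoint_iff.1 (hcon l hl)
      have e1 := siteDist_le_two_of_mem_collar hx
      have e2 := siteDist_le_two_of_mem_collar hy
      have e3 := diam_le_iff.1 hX x hxX y hyX
      have e4 := le_siteDist_mul (by omega) hp (hS m hm) (hS l hl) hml
      have e5 := siteDist_triangle ((m * b : ℕ) : ZMod N) x ((l * b : ℕ) : ZMod N)
      have e6 := siteDist_triangle x y ((l * b : ℕ) : ZMod N)
      rw [siteDist_comm y] at e6
      omega
    obtain ⟨m, hm, hmX⟩ := hex
    have hN : 4 ≤ N := hb.trans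
      ((Nat.le_mul_of_pos_left b (Nat.zero_lt_of_lt (hS m hm))).trans hp)
    have hS' : ∀ l ∈ S.erase m, l < p := fun l hl => hS l (Finset.mem_of_mem_erase hl)
    rw [← Finset.insert_erase hm, spacedPairs_insert, apply_tower_pair_union hN
      (disjoint_collar_spacedPairs hb hp (hS m hm) hS' (Finset.notMem_erase m S)) hmX hh,
      ih (S.erase m) hS' (by rw [Finset.card_erase_of_mem hm, hn]; rfl), mul_zero]

theorem propertyP2 : PropertyP2 (pairCreation N) fun r => 2 ^ (r + 2) + 1 := by
  intro r h hh p E hE hp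
  beta_reduce at hp
  have hr : r + 2 < 2 ^ (r + 2) := Nat.lt_two_pow_self
  have h4 : 4 ≤ 2 ^ (r + 2) := by
    rw [pow_add]
    exact Nat.le_mul_of_pos_left _ (by positivity)
  have hS : ∀ l ∈ Finset.range p, l < p := fun l hl => Finset.mem_range.1 hl
  have h1 := congrFun hE (indicator (spacedPairs N (2 ^ (r + 2) + 1) (Finset.range p)))
  have h2 := tower_spacedPairs (by omega) hp (Finset.range p) hS
  rw [Finset.card_range] at h2
  rw [Pi.smul_apply, h2, localSum, LinearMap.sum_apply, Finset.sum_apply,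
    Finset.sum_eq_zero, eq_comm, smul_eq_zero] at h1
  · exact h1.resolve_right (by exact_mod_cast p.factorial_ne_zero)
  · intro X hX
    have hX' := (Finset.mem_filter.1 hX).2
    obtain ⟨g1, g2, g3⟩ := hh X hX'
    have := apply_tower_spacedPairs_eq_zero (by omega) (by omega) hp hX' g1 g2 g3
      (Finset.range p) hS
    rwa [Finset.card_range] at this

end FiniteFraction

/-! ### Splitting local operators modulo local annihilators -/

section Decomposition

variable {N : ℕ}

theorem pair_injective (hN : 3 ≤ N) : Function.Injective (pair (N := N)) := by
  intro i j h
  have hi : i ∈ pair j := h ▸ by simp [pair]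
  have hj : j ∈ pair i := h ▸ by simp [pair]
  simp only [pair, Finset.mem_insert, Finset.mem_singleton] at hi hj
  rcases hi with hi | hi
  · exact hi
  rcases hj with hj | hj
  · exact hj.symm
  have h2 : ((2 : ℕ) : ZMod N) ≠ (0 : ℕ) := natCast_ne_natCast (by omega) (by omega) (by omega)
  refine absurd ?_ h2
  push_cast
  linear_combination (exp := 1) -hi - hj

theorem opString_mem_supportedOn {A B X : Finset (ZMod N)} (h : A ∪ B ⊆ X) :
    opString A B ∈ supportedOn X :=
  Submodule.subset_span ⟨A, B, h, rfl⟩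

theorem card_pair (hN : 3 ≤ N) (i : ZMod N) : (pair i).card = 2 := by
  have : Fact (1 < N) := ⟨by omega⟩
  exact Finset.card_pair (by simp)

/-- A site at which a set of particles `C` is anchored: a member of `C` if there is one. -/
noncomputable def anchor (C : Finset (ZMod N)) : ZMod N :=
  open Classical in if h : C.Nonempty then h.choose else 0

theorem anchor_mem {C : Finset (ZMod N)} (h : C.Nonempty) : anchor C ∈ C := by
  rw [anchor, dif_pos h]
  exact h.choose_spec

theorem hasRange_mono {s t : ℕ} (h : s ≤ t) : hasRange N s ≤ hasRange N t := by
  refine Submodule.span_mono ?_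
  rintro _ ⟨A, B, hAB, rfl⟩
  exact ⟨A, B, hAB.trans h, rfl⟩

theorem one_mem_hasRange (s : ℕ) : (1 : Op N) ∈ hasRange N s :=
  Submodule.subset_span ⟨∅, ∅, by simp [diam_empty], opString_empty_empty.symm⟩

/-- The submodule of operators supported within `X` that annihilate the vacuum and `|Q⟩`. -/
noncomputable def annihilators [NeZero N] (X : Finset (ZMod N)) : Submodule ℂ (Op N) :=
  supportedOn X ⊓ (LinearMap.ker (LinearMap.applyₗ (tower (pairCreation N) 1))
    ⊓ LinearMap.ker (LinearMap.applyₗ (vacuum N)))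

/-- Sums of annihilators of the vacuum and of `|Q⟩` whose supports have diameter at most `r`. -/
noncomputable def localAnnihilators (N r : ℕ) [NeZero N] : Submodule ℂ (Op N) :=
  ⨆ X ∈ Finset.univ.filter fun X : Finset (ZMod N) => diam X ≤ r, annihilators X

variable [NeZero N]

theorem mem_annihilators {X : Finset (ZMod N)} {h : Op N} :
    h ∈ annihilators X
      ↔ h ∈ supportedOn X ∧ h (tower (pairCreation N) 1) = 0 ∧ h (vacuum N) = 0 :=
  Iff.rfl

theorem mem_localAnnihilators {r : ℕ} {X : Finset (ZMod N)} (hX : diam X ≤ r) {h : Op N}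
    (hh : h ∈ annihilators X) : h ∈ localAnnihilators N r :=
  Submodule.mem_iSup_of_mem X
    (Submodule.mem_iSup_of_mem (Finset.mem_filter.2 ⟨Finset.mem_univ _, hX⟩) hh)

theorem exists_family_of_mem_localAnnihilators {r : ℕ} {O : Op N}
    (hO : O ∈ localAnnihilators N r) :
    ∃ h : Finset (ZMod N) → Op N,
      IsAnnihilatorFamily (pairCreation N) r h ∧ O = localSum r h := by
  obtain ⟨h, hh⟩ := (Submodule.mem_iSup_finset_iff_exists_sum _ _).1 hO
  exact ⟨fun X => h X, fun X _ => mem_annihilators.1 (h X).2, hh.symm⟩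

theorem localAnnihilators_apply {r : ℕ} {O : Op N} (hO : O ∈ localAnnihilators N r) :
    O (tower (pairCreation N) 1) = 0 ∧ O (vacuum N) = 0 := by
  obtain ⟨h, hh, rfl⟩ := exists_family_of_mem_localAnnihilators hO
  constructor
  · rw [localSum, LinearMap.sum_apply]
    exact Finset.sum_eq_zero fun X hX => (hh X (Finset.mem_filter.1 hX).2).2.1
  · rw [localSum, LinearMap.sum_apply]
    exact Finset.sum_eq_zero fun X hX => (hh X (Finset.mem_filter.1 hX).2).2.2

theorem tower_one (hN : 3 ≤ N) : tower (pairCreation N) 1 = ∑ i : ZMod N, ket (pair i) := by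
  have : Fact (1 < N) := ⟨by omega⟩
  rw [tower_succ, tower_zero, vacuum_eq_ket, pairCreation, LinearMap.sum_apply]
  refine Finset.sum_congr rfl fun i _ => ?_
  rw [Module.End.mul_apply, raise_ket, if_neg (Finset.notMem_empty _), raise_ket, if_neg]
  · rfl
  · simp

theorem opString_tower_one (hN : 3 ≤ N) (A B : Finset (ZMod N)) :
    opString A B (tower (pairCreation N) 1) = ∑ i : ZMod N,
      if B ⊆ pair i ∧ Disjoint A (pair i \ B) then ket (A ∪ (pair i \ B)) else 0 := by
  rw [tower_one hN, map_sum]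
  exact Finset.sum_congr rfl fun i _ => opString_ket _ _ _

theorem opString_pair_tower_one (hN : 3 ≤ N) (A : Finset (ZMod N)) (i : ZMod N) :
    opString A (pair i) (tower (pairCreation N) 1) = ket A := by
  rw [opString_tower_one hN, Finset.sum_eq_single i]
  · simp
  · intro j _ hj
    rw [if_neg]
    rintro ⟨h, -⟩
    refine hj (pair_injective hN (Finset.eq_of_subset_of_card_le h ?_)).symm
    rw [card_pair hN, card_pair hN]
  · simp

theorem opString_singleton_tower_one (hN : 3 ≤ N) (A : Finset (ZMod N)) (i : ZMod N) :
    opString A {i} (tower (pairCreation N) 1)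
      = (if i + 1 ∈ A then 0 else ket (insert (i + 1) A))
        + (if i - 1 ∈ A then 0 else ket (insert (i - 1) A)) := by
  have : Fact (1 < N) := ⟨by omega⟩
  have h1 : i - 1 ≠ i := by simp
  have e1 : pair i \ {i} = {i + 1} := by
    ext x
    have : i + 1 ≠ i := by simp
    simp only [pair, Finset.mem_sdiff, Finset.mem_insert, Finset.mem_singleton]
    constructor
    · tauto
    · rintro rfl; tauto
  have e2 : pair (i - 1) \ {i} = {i - 1} := by
    ext x
    simp only [pair, sub_add_cancel, Finset.mem_sdiff, Finset.mem_insert, Finset.mem_singleton]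
    constructor
    · tauto
    · rintro rfl; tauto
  rw [opString_tower_one hN, Finset.sum_eq_add i (i - 1) h1.symm]
  · have e3 : ({i} : Finset (ZMod N)) ⊆ pair i := by simp [pair]
    have e4 : ({i} : Finset (ZMod N)) ⊆ pair (i - 1) := by simp [pair]
    simp only [e1, e2, e3, e4, true_and, Finset.disjoint_singleton_right, ite_not,
      Finset.union_singleton]
  · rintro j - ⟨hj1, hj2⟩
    rw [if_neg]
    rintro ⟨h, -⟩
    rw [Finset.singleton_subset_iff, pair, Finset.mem_insert, Finset.mem_singleton] at h
    rcases h with h | h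
    · exact hj1 h.symm
    · exact hj2 (by rw [h]; simp)
  · simp
  · simp

/-- Two strings that replace different pairs by the same particles `C` differ by an
annihilator. -/
theorem opString_pair_sub_mem (hN : 3 ≤ N) (C : Finset (ZMod N)) (i j : ZMod N) :
    opString C (pair i) - opString C (pair j) ∈ annihilators (C ∪ (pair i ∪ pair j)) := by
  have hne : ∀ i : ZMod N, pair i ≠ ∅ := fun i => by simp [pair]
  refine mem_annihilators.2 ⟨Submodule.sub_mem _ (opString_mem_supportedOn ?_)
    (opString_mem_supportedOn ?_), ?_, ?_⟩
  · exact Finset.union_subset_union_right Finset.subset_union_left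
  · exact Finset.union_subset_union_right Finset.subset_union_right
  · rw [LinearMap.sub_apply, opString_pair_tower_one hN, opString_pair_tower_one hN, sub_self]
  · rw [LinearMap.sub_apply, opString_vacuum, opString_vacuum, if_neg (hne i), if_neg (hne j),
      sub_self]

/-- Telescoping around the chain. -/
theorem opString_empty_pair_sub_mem (hN : 3 ≤ N) {r : ℕ} (hr : 3 ≤ r) (i : ZMod N) :
    opString ∅ (pair i) - opString ∅ (pair 0) ∈ localAnnihilators N r := by
  obtain ⟨m, rfl⟩ := ZMod.natCast_zmod_surjective i
  induction m with
  | zero => simp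
  | succ m ih =>
    rw [← sub_add_sub_cancel _ (opString ∅ (pair (m : ZMod N)))]
    refine Submodule.add_mem _ (mem_localAnnihilators ?_ (opString_pair_sub_mem hN _ _ _)) ih
    refine (diam_le_add (X := {(m : ZMod N) + 1}) (m := 1) (r := 1) ?_ ?_).trans hr
    · simp [diam_le_iff, siteDist_self]
    · intro y hy
      refine ⟨_, Finset.mem_singleton_self _, ?_⟩
      simp only [Finset.empty_union, Finset.mem_union, Nat.cast_add, Nat.cast_one] at hy
      rcases hy with hy | hy
      · rw [siteDist_comm]
        exact siteDist_le_one_of_mem_pair hy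
      · simp only [pair, Finset.mem_insert, Finset.mem_singleton] at hy
        rcases hy with rfl | rfl
        · exact siteDist_add_one_le _
        · simp [siteDist_self]

theorem opString_pair_sub_anchor_mem (hN : 3 ≤ N) {C : Finset (ZMod N)} {i : ZMod N} {r s : ℕ}
    (hs : diam (C ∪ pair i) ≤ s) (hr : s + 2 ≤ r) :
    opString C (pair i) - opString C (pair (anchor C)) ∈ localAnnihilators N r := by
  rcases C.eq_empty_or_nonempty with rfl | hC
  · have hs1 : 0 < s := by
      have := diam_le_iff.1 hs i (by simp [pair]) i (by simp [pair])
      omega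
    have h1 := opString_empty_pair_sub_mem hN (r := r) (by omega) i
    have h2 := opString_empty_pair_sub_mem hN (r := r) (by omega) (anchor (∅ : Finset (ZMod N)))
    simpa using Submodule.sub_mem _ h1 h2
  · refine mem_localAnnihilators ((diam_le_add (m := 1) hs ?_).trans hr)
      (opString_pair_sub_mem hN _ _ _)
    intro y hy
    by_cases hy' : y ∈ C ∪ pair i
    · exact ⟨y, hy', by simp [siteDist_self]⟩
    · have : y ∈ pair (anchor C) := by
        simp only [Finset.mem_union] at hy hy'
        tauto
      refine ⟨anchor C, Finset.mem_union_left _ (anchor_mem hC), ?_⟩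
      rw [siteDist_comm]
      exact siteDist_le_one_of_mem_pair this

/-- The span of the creation strings `s†_C`, of the strings `s†_C s_j s_{j+1}` that replace the
pair at the anchor `j` of `C` by `C`, and of the local annihilators. Every operator of finite
range lies in it, by `hasRange_le_normalForms`. -/
noncomputable def normalForms (N r : ℕ) [NeZero N] : Submodule ℂ (Op N) :=
  Submodule.span ℂ (Set.range fun C : Finset (ZMod N) => opString C ∅)
    ⊔ Submodule.span ℂ (Set.range fun C : Finset (ZMod N) => opString C (pair (anchor C)))
    ⊔ localAnnihilators N r

theorem localAnnihilators_le_normalForms (r : ℕ) : localAnnihilators N r ≤ normalForms N r :=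
  le_sup_right

theorem opString_pair_mem_normalForms (hN : 3 ≤ N) {C : Finset (ZMod N)} {i : ZMod N} {r s : ℕ}
    (hs : diam (C ∪ pair i) ≤ s) (hr : s + 2 ≤ r) : opString C (pair i) ∈ normalForms N r := by
  rw [← sub_add_cancel (opString C (pair i)) (opString C (pair (anchor C)))]
  refine Submodule.add_mem _
    (localAnnihilators_le_normalForms r (opString_pair_sub_anchor_mem hN hs hr)) ?_
  exact Submodule.mem_sup_left (Submodule.mem_sup_right (Submodule.subset_span ⟨C, rfl⟩))

/-- A single lowering operator is traded for strings that lower a full pair: subtracting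
`s†_A s†_j s_j s_i` for both neighbours `j` of `i` yields an annihilator. -/
theorem opString_singleton_mem_normalForms (hN : 3 ≤ N) {A : Finset (ZMod N)} {i : ZMod N}
    {r s : ℕ} (hs : diam (A ∪ {i}) ≤ s) (hr : s + 4 ≤ r) : opString A {i} ∈ normalForms N r := by
  have hpair : pair (i - 1) = {i - 1, i} := by simp [pair]
  have hd : ∀ Y : Finset (ZMod N), Y ⊆ A ∪ {i - 1, i, i + 1} → diam Y ≤ s + 2 := by
    intro Y hY
    refine diam_le_add (m := 1) hs fun y hy => ?_
    have hy := hY hy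
    simp only [Finset.mem_union, Finset.mem_insert, Finset.mem_singleton] at hy
    rcases hy with hy | rfl | rfl | rfl
    · exact ⟨y, Finset.mem_union_left _ hy, by simp [siteDist_self]⟩
    · refine ⟨i, by simp, ?_⟩
      have := siteDist_add_one_le (i - 1)
      rwa [sub_add_cancel] at this
    · exact ⟨y, by simp, by simp [siteDist_self]⟩
    · refine ⟨i, by simp, ?_⟩
      rw [siteDist_comm]
      exact siteDist_add_one_le i
  have hsub1 : insert (i + 1) A ∪ pair i ⊆ A ∪ {i - 1, i, i + 1} := by
    intro y
    simp only [pair, Finset.mem_union, Finset.mem_insert, Finset.mem_singleton]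
    tauto
  have hsub2 : insert (i - 1) A ∪ pair (i - 1) ⊆ A ∪ {i - 1, i, i + 1} := by
    intro y
    simp only [hpair, Finset.mem_union, Finset.mem_insert, Finset.mem_singleton]
    tauto
  set T1 : Op N := if i + 1 ∈ A then 0 else opString (insert (i + 1) A) (pair i) with hT1
  set T2 : Op N := if i - 1 ∈ A then 0 else opString (insert (i - 1) A) (pair (i - 1)) with hT2
  have h1 : T1 ∈ normalForms N r := by
    rw [hT1]
    split_ifs
    · exact Submodule.zero_mem _
    · exact opString_pair_mem_normalForms hN (hd _ hsub1) hr
  have h2 : T2 ∈ normalForms N r := by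
    rw [hT2]
    split_ifs
    · exact Submodule.zero_mem _
    · exact opString_pair_mem_normalForms hN (hd _ hsub2) hr
  have hann : opString A {i} - (T1 + T2) ∈ annihilators (A ∪ {i - 1, i, i + 1}) := by
    have hne : ∀ i : ZMod N, pair i ≠ ∅ := fun i => by simp [pair]
    refine mem_annihilators.2 ⟨Submodule.sub_mem _ (opString_mem_supportedOn ?_)
      (Submodule.add_mem _ ?_ ?_), ?_, ?_⟩
    · intro y
      simp only [Finset.mem_union, Finset.mem_insert, Finset.mem_singleton]
      tauto
    · rw [hT1]
      split_ifs
      · exact Submodule.zero_mem _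
      · exact opString_mem_supportedOn hsub1
    · rw [hT2]
      split_ifs
      · exact Submodule.zero_mem _
      · exact opString_mem_supportedOn hsub2
    · rw [LinearMap.sub_apply, LinearMap.add_apply, opString_singleton_tower_one hN, hT1, hT2,
        sub_eq_zero]
      congr 1
      · split_ifs
        · rfl
        · rw [opString_pair_tower_one hN]
      · split_ifs
        · rfl
        · rw [opString_pair_tower_one hN]
    · rw [LinearMap.sub_apply, LinearMap.add_apply, hT1, hT2]
      split_ifs <;> simp [opString_vacuum, hne]
  rw [← sub_add_cancel (opString A {i}) (T1 + T2)]
  exact Submodule.add_mem _ (localAnnihilators_le_normalForms r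
    (mem_localAnnihilators ((hd _ subset_rfl).trans (by omega)) hann))
    (Submodule.add_mem _ h1 h2)

/-- A string that lowers a set of sites not contained in a neighbouring pair is itself an
annihilator; the subsets of a pair are treated one by one. -/
theorem opString_mem_normalForms (hN : 3 ≤ N) {A B : Finset (ZMod N)} {r s : ℕ}
    (hs : diam (A ∪ B) ≤ s) (hr : s + 4 ≤ r) : opString A B ∈ normalForms N r := by
  by_cases hB : ∃ i, B ⊆ pair i
  · obtain ⟨i, hB⟩ := hB
    rw [pair, ← Finset.coe_subset, Finset.coe_pair, Set.subset_pair_iff_eq] at hB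
    norm_cast at hB
    rcases hB with rfl | rfl | rfl | rfl
    · exact Submodule.mem_sup_left (Submodule.mem_sup_left (Submodule.subset_span ⟨A, rfl⟩))
    · exact opString_singleton_mem_normalForms hN hs hr
    · exact opString_singleton_mem_normalForms hN hs hr
    · exact opString_pair_mem_normalForms hN hs (by omega)
  · push Not at hB
    have hB0 : B ≠ ∅ := by
      rintro rfl
      exact hB 0 (Finset.empty_subset _)
    refine localAnnihilators_le_normalForms r (mem_localAnnihilators (hs.trans (by omega))
      (mem_annihilators.2 ⟨opString_mem_supportedOn subset_rfl, ?_, ?_⟩))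
    · rw [opString_tower_one hN]
      exact Finset.sum_eq_zero fun i _ => if_neg fun h => hB i h.1
    · rw [opString_vacuum, if_neg hB0]

theorem hasRange_le_normalForms (hN : 3 ≤ N) {s r : ℕ} (hr : s + 4 ≤ r) :
    hasRange N s ≤ normalForms N r := by
  refine Submodule.span_le.2 ?_
  rintro _ ⟨A, B, hAB, rfl⟩
  exact opString_mem_normalForms hN hAB hr

theorem sum_smul_ket_eq_zero {a : Finset (ZMod N) → ℂ} (h : ∑ C, a C • ket C = 0)
    (C : Finset (ZMod N)) : a C = 0 := by
  have := congrFun h (indicator C)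
  simpa [Finset.sum_apply, ket_indicator] using this

/-- Creation strings are detected by the vacuum and anchored pair strings by `|Q⟩`, so an
operator that annihilates both is a sum of local annihilators. -/
theorem mem_localAnnihilators_of_apply_eq_zero (hN : 3 ≤ N) {r : ℕ} {O : Op N}
    (hO : O ∈ normalForms N r) (h1 : O (tower (pairCreation N) 1) = 0)
    (h0 : O (vacuum N) = 0) : O ∈ localAnnihilators N r := by
  obtain ⟨y, hy, n, hn, rfl⟩ := Submodule.mem_sup.1 hO
  obtain ⟨u, hu, v, hv, rfl⟩ := Submodule.mem_sup.1 hy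
  obtain ⟨a, rfl⟩ := (Submodule.mem_span_range_iff_exists_fun ℂ).1 hu
  obtain ⟨b, rfl⟩ := (Submodule.mem_span_range_iff_exists_fun ℂ).1 hv
  obtain ⟨hn1, hn0⟩ := localAnnihilators_apply hn
  have hne : ∀ i : ZMod N, pair i ≠ ∅ := fun i => by simp [pair]
  have ha : ∀ C, a C = 0 := by
    refine sum_smul_ket_eq_zero ?_
    simpa [LinearMap.sum_apply, opString_vacuum, hn0, hne] using h0
  have hb : ∀ C, b C = 0 := by
    refine sum_smul_ket_eq_zero ?_
    simpa [LinearMap.sum_apply, opString_pair_tower_one hN, hn1, ha] using h1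
  simpa [ha, hb] using hn

theorem number_mem_hasRange (s : ℕ) : number N ∈ hasRange N (s + 1) := by
  refine Submodule.sum_mem _ fun i _ => Submodule.subset_span
    ⟨{i}, {i}, ?_, (opString_singleton_singleton i).symm⟩
  simp [diam_le_iff, siteDist_self]

theorem decomposes_of_vacuum_eigenvector (hN : 3 ≤ N) {R r : ℕ} (hr : R + 5 ≤ r) {H : Op N}
    {E E₀ : ℂ} (hH : H ∈ hasRange N R)
    (h1 : H (tower (pairCreation N) 1) = E • tower (pairCreation N) 1)
    (h0 : H (vacuum N) = E₀ • vacuum N) : ∃ Ω ω : ℂ, Decomposes (pairCreation N) r Ω ω H := by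
  have hmem : H - E₀ • (1 : Op N) - ((E - E₀) / 2) • number N ∈ hasRange N (R + 1) :=
    Submodule.sub_mem _ (Submodule.sub_mem _ (hasRange_mono (by omega) hH)
      (Submodule.smul_mem _ _ (one_mem_hasRange _)))
      (Submodule.smul_mem _ _ (number_mem_hasRange _))
  obtain ⟨h, hh, hsum⟩ : ∃ h, IsAnnihilatorFamily (pairCreation N) r h ∧
      H - E₀ • (1 : Op N) - ((E - E₀) / 2) • number N = localSum r h := by
    refine exists_family_of_mem_localAnnihilators (mem_localAnnihilators_of_apply_eq_zero hN
      (hasRange_le_normalForms hN hr hmem) ?_ ?_)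
    · simp only [LinearMap.sub_apply, LinearMap.smul_apply, Module.End.one_apply, h1,
        number_tower]
      push_cast
      module
    · simp [h0, number_vacuum]
  refine ⟨E₀, (E - E₀) / 2, h, hh, ?_⟩
  rw [← hsum]
  abel

end Decomposition

/-! ### The vacuum on long chains -/

section LongChain

variable {N : ℕ}

theorem le_siteDist_add {b m : ℕ} (i : ZMod N) (hm : b ≤ m) (hl : m + b ≤ N) (hb : 0 < b) :
    b ≤ siteDist i (i + m) := by
  have := le_siteDist_natCast (N := N) (m := 0) (l := m) (by omega) (by omega) hb
  simpa [siteDist] using this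

theorem siteDist_le_one_of_mem_pair_of_mem_pair {i x y : ZMod N} (hx : x ∈ pair i)
    (hy : y ∈ pair i) : siteDist x y ≤ 1 := by
  simp only [pair, Finset.mem_insert, Finset.mem_singleton] at hx hy
  rcases hx with rfl | rfl <;> rcases hy with rfl | rfl
  · simp [siteDist_self]
  · exact siteDist_add_one_le _
  · rw [siteDist_comm]
    exact siteDist_add_one_le _
  · simp [siteDist_self]

/-- A short string that produces two far apart clusters `A` and a pair out of a pair leaves
one of the clusters untouched; the latter is then the initial pair. -/
theorem opString_ket_pair_union [NeZero N] (hN : 3 ≤ N) {R : ℕ} {A A' B' : Finset (ZMod N)}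
    (hR : diam (A' ∪ B') ≤ R) (hA : A.Nonempty) {i : ZMod N}
    (hfar : ∀ x ∈ A, ∀ y ∈ pair i, R + 2 ≤ siteDist x y) (l : ZMod N) :
    opString A' B' (ket (pair l)) (indicator (A ∪ pair i))
      = (if l = i then opString A' B' (vacuum N) (indicator A) else 0)
        + (if pair l = A then opString A' B' (vacuum N) (indicator (pair i)) else 0) := by
  obtain ⟨a, ha⟩ := hA
  have hi : i ∈ pair i := by simp [pair]
  have hdisj : Disjoint A (pair i) := by
    rw [Finset.disjoint_left]
    intro x hx hx'
    have := hfar x hx x hx'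
    rw [siteDist_self] at this
    omega
  have hcases : Disjoint A' (pair i) ∨ Disjoint A' A := by
    by_contra! hcon
    obtain ⟨y, hy, hy'⟩ := Finset.not_disjoint_iff.1 hcon.1
    obtain ⟨x, hx, hx'⟩ := Finset.not_disjoint_iff.1 hcon.2
    have h1 := diam_le_iff.1 hR x (Finset.mem_union_left _ hx) y (Finset.mem_union_left _ hy)
    have h2 := hfar x hx' y hy'
    omega
  have hsub (U V : Finset (ZMod N)) (h : A' ∪ V = A ∪ pair i) (hU : U ⊆ A ∪ pair i)
      (hA'U : Disjoint A' U) : U ⊆ V := by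
    intro x hx
    rcases Finset.mem_union.1 (h ▸ hU hx) with h' | h'
    · exact absurd hx (Finset.disjoint_left.1 hA'U h')
    · exact h'
  rw [opString_ket]
  simp only [opString_vacuum]
  by_cases hB : B' = ∅
  · subst hB
    simp only [Finset.empty_subset, Finset.sdiff_empty, true_and, if_true, ket_indicator]
    have hiff : (Disjoint A' (pair l) ∧ A' ∪ pair l = A ∪ pair i)
        ↔ (l = i ∧ A' = A) ∨ (pair l = A ∧ A' = pair i) := by
      constructor
      · rintro ⟨h1, h2⟩
        have hA' : A' = (A ∪ pair i) \ pair l := by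
          rw [← h2, Finset.union_sdiff_right, Finset.sdiff_eq_self_of_disjoint h1]
        rcases hcases with h | h
        · have h3 : pair i ⊆ pair l := hsub _ _ h2 Finset.subset_union_right h
          have h4 : i = l := pair_injective hN
            (Finset.eq_of_subset_of_card_le h3 (by rw [card_pair hN, card_pair hN]))
          subst h4
          refine Or.inl ⟨rfl, ?_⟩
          rw [hA', Finset.union_sdiff_right, Finset.sdiff_eq_self_of_disjoint hdisj]
        · have h3 : A ⊆ pair l := hsub _ _ h2 Finset.subset_union_left h
          have h4 : pair l = A := by
            refine Finset.Subset.antisymm (fun z hz => ?_) h3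
            rcases Finset.mem_union.1 (h2 ▸ Finset.mem_union_right A' hz) with h' | h'
            · exact h'
            · have h5 := siteDist_le_one_of_mem_pair_of_mem_pair (h3 ha) hz
              have h6 := hfar a ha z h'
              omega
          refine Or.inr ⟨h4, ?_⟩
          rw [hA', h4, Finset.union_sdiff_left, Finset.sdiff_eq_self_of_disjoint hdisj.symm]
      · rintro (⟨rfl, rfl⟩ | ⟨rfl, rfl⟩)
        · exact ⟨hdisj, rfl⟩
        · exact ⟨hdisj.symm, Finset.union_comm _ _⟩
    have hne : l = i → pair l ≠ A := by
      rintro rfl rfl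
      exact Finset.disjoint_left.1 hdisj ha ha
    have hlhs : (if Disjoint A' (pair l) then ket (A' ∪ pair l) else 0) (indicator (A ∪ pair i))
        = if (Disjoint A' (pair l) ∧ A' ∪ pair l = A ∪ pair i) then (1 : ℂ) else 0 := by
      by_cases h : Disjoint A' (pair l) <;> simp [h, ket_indicator]
    rw [hlhs]
    simp only [hiff]
    by_cases h1 : l = i
    · simp [h1, h1 ▸ hne h1]
    · simp [h1, ite_and]
  · have hno : ¬ (B' ⊆ pair l ∧ A' ∪ (pair l \ B') = A ∪ pair i) := by
      rintro ⟨h1, h2⟩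
      obtain ⟨b, hb⟩ := Finset.nonempty_iff_ne_empty.2 hB
      rcases hcases with h | h
      · have h3 := hsub _ _ h2 Finset.subset_union_right h
        have h5 : pair i = pair l := Finset.eq_of_subset_of_card_le
          (h3.trans Finset.sdiff_subset) (by rw [card_pair hN, card_pair hN])
        have h6 := h3 (h5 ▸ h1 hb)
        exact (Finset.mem_sdiff.1 h6).2 hb
      · have h3 := (Finset.mem_sdiff.1 (hsub _ _ h2 Finset.subset_union_left h ha)).1
        have h4 := siteDist_le_one_of_mem_pair_of_mem_pair h3 (h1 hb)
        have h5 := hfar a ha i hi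
        rcases Finset.mem_union.1 (h2.symm ▸ Finset.mem_union_right A hi :
          i ∈ A' ∪ (pair l \ B')) with h' | h'
        · have h6 := diam_le_iff.1 hR b (Finset.mem_union_right _ hb) i
            (Finset.mem_union_left _ h')
          have h7 := siteDist_triangle a b i
          omega
        · have h6 := siteDist_le_one_of_mem_pair_of_mem_pair h3 (Finset.mem_sdiff.1 h').1
          omega
    simp only [hB, if_false]
    by_cases h : B' ⊆ pair l ∧ Disjoint A' (pair l \ B')
    · have : ¬ A' ∪ (pair l \ B') = A ∪ pair i := fun h' => hno ⟨h.1, h'⟩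
      simp [h, ket_indicator, this]
    · simp [h]

theorem hasRange_vacuum_eq_zero {R : ℕ} {A : Finset (ZMod N)} (hA : R < diam A) {H : Op N}
    (hH : H ∈ hasRange N R) : H (vacuum N) (indicator A) = 0 := by
  induction hH using Submodule.span_induction with
  | mem O h =>
    obtain ⟨A', B', h, rfl⟩ := h
    rw [opString_vacuum]
    split_ifs with hB
    · rw [ket_indicator, if_neg]
      rintro rfl
      exact absurd ((diam_mono Finset.subset_union_left).trans h) (by omega)
    · rfl
  | zero => rfl
  | add x y _ _ hx hy => rw [LinearMap.add_apply, Pi.add_apply, hx, hy, add_zero]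
  | smul c x _ hx => rw [LinearMap.smul_apply, Pi.smul_apply, hx, smul_zero]

variable [NeZero N]

open Classical in
/-- The amplitude of `H|Q⟩` on `A` together with a far pair: either the pair is the initial one and
`H` creates `A`, or `A` is the initial pair and `H` creates the far pair. -/
theorem hasRange_apply_tower_one (hN : 3 ≤ N) {R : ℕ} {A : Finset (ZMod N)} (hA : A.Nonempty)
    {i : ZMod N} (hfar : ∀ x ∈ A, ∀ y ∈ pair i, R + 2 ≤ siteDist x y) {H : Op N}
    (hH : H ∈ hasRange N R) :
    H (tower (pairCreation N) 1) (indicator (A ∪ pair i))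
      = H (vacuum N) (indicator A)
        + (if ∃ l, pair l = A then H (vacuum N) (indicator (pair i)) else 0) := by
  induction hH using Submodule.span_induction with
  | mem O h =>
    obtain ⟨A', B', h, rfl⟩ := h
    rw [tower_one hN, map_sum, Finset.sum_apply,
      Finset.sum_congr rfl fun l _ => opString_ket_pair_union hN h hA hfar l,
      Finset.sum_add_distrib, Finset.sum_ite_eq' Finset.univ i, if_pos (Finset.mem_univ _)]
    congr 1
    by_cases hl : ∃ l, pair l = A
    · rw [if_pos hl]
      obtain ⟨l, rfl⟩ := hl
      simp only [(pair_injective hN).eq_iff]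
      rw [Finset.sum_ite_eq' Finset.univ l, if_pos (Finset.mem_univ _)]
    · rw [if_neg hl]
      exact Finset.sum_eq_zero fun l _ => if_neg fun h => hl ⟨l, h⟩
  | zero => simp
  | add x y _ _ hx hy =>
    simp only [LinearMap.add_apply, Pi.add_apply, hx, hy]
    split_ifs <;> ring
  | smul c x _ hx =>
    simp only [LinearMap.smul_apply, Pi.smul_apply, hx, smul_eq_mul]
    split_ifs <;> ring

open Classical in
/-- `|Q⟩` has no amplitude on a configuration with more than one pair, so for an eigenvector the
two contributions cancel. -/
theorem vacuum_amplitude_add (hN : 3 ≤ N) {R : ℕ} {A : Finset (ZMod N)} (hA : A.Nonempty)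
    {i : ZMod N} (hfar : ∀ x ∈ A, ∀ y ∈ pair i, R + 2 ≤ siteDist x y) {H : Op N}
    (hH : H ∈ hasRange N R) {E : ℂ}
    (hE : H (tower (pairCreation N) 1) = E • tower (pairCreation N) 1) :
    H (vacuum N) (indicator A)
        + (if ∃ l, pair l = A then H (vacuum N) (indicator (pair i)) else 0) = 0 := by
  have h1 := hasRange_apply_tower_one hN hA hfar (one_mem_hasRange R)
  have hv : ∀ C : Finset (ZMod N), C.Nonempty → vacuum N (indicator C) = 0 := fun C hC => by
    rw [vacuum_eq_ket, ket_indicator, if_neg hC.ne_empty.symm]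
  have hi : (pair i).Nonempty := ⟨i, by simp [pair]⟩
  rw [Module.End.one_apply, Module.End.one_apply, hv A hA, hv _ hi, ite_self, add_zero] at h1
  rw [← hasRange_apply_tower_one hN hA hfar hH, hE, Pi.smul_apply, h1, smul_zero]

/-- On a long chain the amplitudes of `H |0…0⟩` on two far apart pairs cancel; three mutually
far apart pairs then force them to vanish. -/
theorem vacuum_eigenvector_of_long (hN : 3 ≤ N) {R : ℕ} (hlong : 2 ^ (4 * R) + 1 < N) {H : Op N}
    {E : ℂ} (hH : H ∈ hasRange N R)
    (hE : H (tower (pairCreation N) 1) = E • tower (pairCreation N) 1) :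
    ∃ E₀ : ℂ, H (vacuum N) = E₀ • vacuum N := by
  have key : ∀ A : Finset (ZMod N), A.Nonempty → H (vacuum N) (indicator A) = 0 := by
    intro A hA
    rcases lt_or_ge R (diam A) with hd | hd
    · exact hasRange_vacuum_eq_zero hd hH
    obtain ⟨a, ha⟩ := hA
    have hR : 0 < R := by
      have := diam_le_iff.1 hd a ha a ha
      omega
    have hN' : 15 * R + 1 ≤ 2 ^ (4 * R) := by
      rw [pow_mul]
      clear * -
      induction R with
      | zero => simp
      | succ R ih =>
        rw [pow_succ]
        omega
    -- Spacing that keeps the three clusters `R + 2` apart; `3 m ≤ N` by `hN'` and `hlong`.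
    set m := 2 * R + 3 with hm
    set i := a + (m : ZMod N) with hi
    set k := i + (m : ZMod N) with hk
    have hai : m ≤ siteDist a i := le_siteDist_add a le_rfl (by omega) (by omega)
    have hik : m ≤ siteDist i k := le_siteDist_add i le_rfl (by omega) (by omega)
    have hak : m ≤ siteDist a k := by
      have : k = a + ((m + m : ℕ) : ZMod N) := by
        rw [hk, hi]
        push_cast
        ring
      rw [this]
      exact le_siteDist_add a (by omega) (by omega) (by omega)
    have hfar : ∀ j, m ≤ siteDist a j → ∀ x ∈ A, ∀ y ∈ pair j, R + 2 ≤ siteDist x y := by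
      intro j hj x hx y hy
      have h1 := diam_le_iff.1 hd a ha x hx
      have h2 := siteDist_le_one_of_mem_pair hy
      have h3 := siteDist_triangle a x j
      have h4 := siteDist_triangle x y j
      rw [siteDist_comm y] at h4
      omega
    have hfar' : ∀ x ∈ pair i, ∀ y ∈ pair k, R + 2 ≤ siteDist x y := by
      intro x hx y hy
      have h1 := siteDist_le_one_of_mem_pair hx
      have h2 := siteDist_le_one_of_mem_pair hy
      have h3 := siteDist_triangle i x k
      have h4 := siteDist_triangle x y k
      rw [siteDist_comm y] at h4
      omega
    have e1 := vacuum_amplitude_add hN ⟨a, ha⟩ (hfar i hai) hH hE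
    have e2 := vacuum_amplitude_add hN ⟨a, ha⟩ (hfar k hak) hH hE
    have e3 := vacuum_amplitude_add hN ⟨i, by simp [pair]⟩ hfar' hH hE
    rw [if_pos ⟨i, rfl⟩] at e3
    split_ifs at e1 e2 with hl
    · linear_combination (e1 + e2 - e3) / 2
    · simpa using e1
  refine ⟨H (vacuum N) (indicator ∅), ?_⟩
  funext σ
  obtain ⟨C, rfl⟩ := exists_eq_indicator σ
  rcases C.eq_empty_or_nonempty with rfl | hC
  · simp [vacuum_eq_ket, ket_indicator]
  · rw [key C hC, Pi.smul_apply, vacuum_eq_ket, ket_indicator, if_neg hC.ne_empty.symm,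
      smul_zero]

theorem propertyP1 (hN : 3 ≤ N) : PropertyP1 (pairCreation N) fun R => 2 * R + 408 := by
  intro R H E hH hE h
  -- Supports of diameter `R + 5` already suffice.
  obtain ⟨E₀, h0⟩ : ∃ E₀ : ℂ, H (vacuum N) = E₀ • vacuum N :=
    h.elim (fun h => vacuum_eigenvector_of_long hN h hH hE) id
  exact decomposes_of_vacuum_eigenvector hN (r := 2 * R + 408) (by omega) hH hE h0

end LongChain

/-! ### Equal spacing -/

section EqualSpacing

variable {N : ℕ}

theorem kLocal_mono {k l : ℕ} (h : k ≤ l) : kLocal N k ≤ kLocal N l := by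
  refine Submodule.span_mono ?_
  rintro _ ⟨A, B, hAB, rfl⟩
  exact ⟨A, B, hAB.trans h, rfl⟩

theorem exists_eq_smul_one_of_mem_kLocal_zero {H : Op N} (hH : H ∈ kLocal N 0) :
    ∃ c : ℂ, H = c • (1 : Op N) := by
  induction hH using Submodule.span_induction with
  | mem O h =>
    obtain ⟨A, B, h, rfl⟩ := h
    rw [Nat.le_zero, Finset.card_eq_zero, Finset.union_eq_empty] at h
    rw [h.1, h.2, opString_empty_empty]
    exact ⟨1, (one_smul _ _).symm⟩
  | zero => exact ⟨0, (zero_smul _ _).symm⟩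
  | add x y _ _ hx hy =>
    obtain ⟨c, rfl⟩ := hx
    obtain ⟨d, rfl⟩ := hy
    exact ⟨c + d, (add_smul _ _ _).symm⟩
  | smul c x _ hx =>
    obtain ⟨d, rfl⟩ := hx
    exact ⟨c * d, smul_smul _ _ _⟩

variable [NeZero N]

theorem number_mem_kLocal : number N ∈ kLocal N 1 :=
  Submodule.sum_mem _ fun i _ => Submodule.subset_span
    ⟨{i}, {i}, by simp, (opString_singleton_singleton i).symm⟩

/-- After subtracting `Ω + ω n̂`, the tower is annihilated on a finite fraction of its states,
which is more than locality needs to annihilate all of it. -/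
theorem equal_spacing {α β γ : ℕ → ℕ} (hP1 : PropertyP1 (pairCreation N) α)
    (hP2 : PropertyP2 (pairCreation N) β) (hP3 : PropertyP3 (pairCreation N) γ)
    {R k : ℕ} {H : Op N} {E : ℕ → ℂ} (hR : H ∈ hasRange N R) (hk : H ∈ kLocal N k)
    (hE : ∀ p, H (tower (pairCreation N) p) = E p • tower (pairCreation N) p)
    (hN : β (α R) * γ k < N) :
    ∃ Ω ω : ℂ, Decomposes (pairCreation N) (α R) Ω ω H ∧
      ∀ p, tower (pairCreation N) p ≠ 0 → E p = Ω + 2 * ω * p := by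
  rcases Nat.eq_zero_or_pos k with rfl | hk0
  · -- A `0`-local operator is a scalar, but subtracting `ω n̂` from it would not be `0`-local.
    obtain ⟨c, rfl⟩ := exists_eq_smul_one_of_mem_kLocal_zero hk
    refine ⟨c, 0, ⟨0, fun X _ => ⟨Submodule.zero_mem _, rfl, rfl⟩, by simp [localSum]⟩, ?_⟩
    intro p hp
    have h := hE p
    rw [LinearMap.smul_apply, Module.End.one_apply] at h
    rw [← smul_left_injective ℂ hp h]
    ring
  obtain ⟨Ω, ω, h, hh, hH⟩ := hP1 R H (E 1) hR (hE 1)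
    (Or.inr ⟨E 0, by simpa [tower_zero] using hE 0⟩)
  refine ⟨Ω, ω, ⟨h, hh, hH⟩, ?_⟩
  have hsub : localSum (α R) h = H - Ω • (1 : Op N) - ω • number N := by
    rw [hH]
    abel
  have hval : ∀ p, localSum (α R) h (tower (pairCreation N) p)
      = (E p - Ω - 2 * ω * p) • tower (pairCreation N) p := by
    intro p
    rw [hsub]
    simp only [LinearMap.sub_apply, LinearMap.smul_apply, Module.End.one_apply, hE, number_tower]
    module
  have hloc : localSum (α R) h ∈ kLocal N k := by
    rw [hsub]
    refine Submodule.sub_mem _ (Submodule.sub_mem _ hk (Submodule.smul_mem _ _ ?_))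
      (Submodule.smul_mem _ _ (kLocal_mono hk0 number_mem_kLocal))
    exact Submodule.subset_span ⟨∅, ∅, by simp, opString_empty_empty.symm⟩
  have hzero : ∀ q ≤ γ k, localSum (α R) h (tower (pairCreation N) q) = 0 := by
    intro q hq
    have hqN : q * β (α R) ≤ N := by
      rw [mul_comm]
      exact (Nat.mul_le_mul_left _ hq).trans hN.le
    rw [hval q, hP2 _ h hh q _ (hval q) hqN, zero_smul]
  intro p hp
  have h0 := hP3 k _ hloc hzero p
  rw [hval p, smul_eq_zero] at h0
  linear_combination h0.resolve_right hp

end EqualSpacing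

end PairTower

theorem mainTheorem11 :
    ∃ α β γ : ℕ → ℕ,
      (∀ R, α R ≤ 2 * R + 408) ∧ (∀ r, β r ≤ 2 ^ (r + 2) + 1) ∧ (∀ k, γ k ≤ 2 * k) ∧
      ∀ (N : ℕ) [NeZero N], 3 ≤ N →
        PairTower.number N * PairTower.pairCreation N
            - PairTower.pairCreation N * PairTower.number N
          = (2 : ℂ) • PairTower.pairCreation N ∧
        PairTower.PropertyP1 (PairTower.pairCreation N) α ∧
        PairTower.PropertyP2 (PairTower.pairCreation N) β ∧
        PairTower.PropertyP3 (PairTower.pairCreation N) γ ∧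
        ∀ (R k : ℕ) (H : PairTower.Op N) (E : ℕ → ℂ),
          H ∈ PairTower.hasRange N R → H ∈ PairTower.kLocal N k →
          (∀ p, H (PairTower.tower (PairTower.pairCreation N) p)
            = E p • PairTower.tower (PairTower.pairCreation N) p) →
          β (α R) * γ k < N →
          ∃ Ω ω : ℂ,
            PairTower.Decomposes (PairTower.pairCreation N) (α R) Ω ω H ∧
            ∀ p, PairTower.tower (PairTower.pairCreation N) p ≠ 0 →
              E p = Ω + 2 * ω * p := by
  refine ⟨fun R => 2 * R + 408, fun r => 2 ^ (r + 2) + 1, fun k => 2 * k, fun _ => le_rfl,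
    fun _ => le_rfl, fun _ => le_rfl, fun N _ hN => ?_⟩
  have h1 := PairTower.propertyP1 hN
  have h2 := PairTower.propertyP2 (N := N)
  have h3 := PairTower.propertyP3 hN
  exact ⟨PairTower.number_commutator_pairCreation, h1, h2, h3,
    fun R k H E hR hk hE hlt => PairTower.equal_spacing h1 h2 h3 hR hk hE hlt⟩
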